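/- An involution of a unital associative algebra $R$ over a field $F$ is an $F$-linear map $a\mapsto\bar a$ with $\overline{ab}=\bar b\,\bar a$ and $\bar{\bar a}=a$. For such an $R$ (with $F$ of characteristic $0$), an integer $n\ge 1$ and $\rho\in\{1,-1\}$, let $\mathfrak g_{2n,\rho}(R)$ be the Lie subalgebra of $\mathfrak{gl}_{2n}(R)$ over $F$ generated by the elements $$f_{ij}(a)=e_{ij}(a)-e_{n+j,n+i}(\bar a)\ (i\ne j),\quad g_{ij}(a)=e_{i,n+j}(a)-\rho\, e_{j,n+i}(\bar a)\ (i\le j),\quad h_{ij}(a)=e_{n+i,j}(a)-\rho\, e_{n+j,i}(\bar a)\ (i\le j),$$ where $1\le i,j\le n$, $a\in R$, and $e_{ij}(a)$ is the matrix with $a$ at position $(i,j)$ and $0$ elsewhere. For $R=\mathbb C$ the involution is the identity map. For $q\in\{1,-1\}$ let $\mathbb C_q$ be the unital associative $\mathbb C$-algebra generated by $t_1^{\pm1},t_2^{\pm1}$ subject to $t_it_i^{-1}=t_i^{-1}t_i=1$ $(i=1,2)$ and $t_2t_1=q\,t_1t_2$, with the involution determined by $\overline{t_1}=\theta_1t_1$,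 $\overline{t_2}=\theta_2t_2$, where $\theta_1,\theta_2\in\{1,-1\}$. Let $$(q,\theta_1,\theta_2)\in\mathcal P=\{(-1,1,1),(-1,1,-1),(-1,-1,-1),(1,1,1),(1,1,-1),(1,-1,-1)\},$$ and let $m$ be the multiplicative order of $q$ (so $m=1$ if $q=1$ and $m=2$ if $q=-1$). Theorem. Let $n\ge 3$, let $\rho\in\{1,-1\}$, let $(q,\theta_1,\theta_2)\in\mathcal P$, let $V$ be a finite-dimensional irreducible module over the complex Lie algebra $\mathfrak g_{2n,\rho}(\mathbb C_q)$ with $\dim V\ge 2$, and let $\mathrm{Ann}(V)=\{x\in\mathfrak g_{2n,\rho}(\mathbb C_q): x.V=0\}$. 1. If $q=-1$ or $(q,\theta_1,\theta_2)=(1,1,1)$, then there is an integer $k\ge 0$ such that $$\mathfrak g_{2n,\rho}(\mathbb C_q)/\mathrm{Ann}(V)\cong \mathfrak g_{2mn,\theta_1\rho}(\mathbb C)^{k}$$ as complex Lie algebras. 2. If $(q,\theta_1,\theta_2)=(1,1,-1)$ or $(1,-1,-1)$, then there is an integer $k\ge 0$ such that $$\mathfrak g_{2n,\rho}(\mathbb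 C_q)/\mathrm{Ann}(V)\cong \mathfrak{sl}_{2n}(\mathbb C)^{k}$$ as complex Lie algebras. Here $L^k$ denotes the direct sum of $k$ copies of $L$. -/

import Mathlib

/-- An involution of an associative `k`-algebra `R`: a `k`-linear map `a ↦ bar a`
with `bar (a * b) = bar b * bar a` and `bar (bar a) = a`. -/
structure AlgInvolution (k R : Type*) [CommRing k] [Ring R] [Algebra k R] where
  bar : R →ₗ[k] R
  bar_mul : ∀ a b : R, bar (a * b) = bar b * bar a
  bar_bar : ∀ a : R, bar (bar a) = a

/-- The identity map, an involution of any commutative algebra. -/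
def AlgInvolution.identity (k R : Type*) [CommRing k] [CommRing R] [Algebra k R] :
    AlgInvolution k R where
  bar := LinearMap.id
  bar_mul a b := mul_comm a b
  bar_bar _ := rfl

attribute [local instance 100] LieRing.ofAssociativeRing

section UnitaryLie

variable {k R : Type*} [CommRing k] [Ring R] [Algebra k R]

/-- `f_{ij}(a) = e_{ij}(a) - e_{n+j,n+i}(bar a)`. Of the `2 n` matrix indices the first `n` are
the `Sum.inl i` and the last `n` (the indices `n + i`) are the `Sum.inr i`. -/
def fMat (σ : AlgInvolution k R) {n : ℕ} (i j : Fin n) (a : R) :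
    Matrix (Fin n ⊕ Fin n) (Fin n ⊕ Fin n) R :=
  Matrix.single (Sum.inl i) (Sum.inl j) a - Matrix.single (Sum.inr j) (Sum.inr i) (σ.bar a)

/-- `g_{ij}(a) = e_{i,n+j}(a) - ρ e_{j,n+i}(bar a)`. The type `ℤˣ` is `{1, -1}`. -/
def gMat (σ : AlgInvolution k R) (ρ : ℤˣ) {n : ℕ} (i j : Fin n) (a : R) :
    Matrix (Fin n ⊕ Fin n) (Fin n ⊕ Fin n) R :=
  Matrix.single (Sum.inl i) (Sum.inr j) a -
    Matrix.single (Sum.inl j) (Sum.inr i) ((ρ : ℤ) • σ.bar a)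

/-- `h_{ij}(a) = e_{n+i,j}(a) - ρ e_{n+j,i}(bar a)`. -/
def hMat (σ : AlgInvolution k R) (ρ : ℤˣ) {n : ℕ} (i j : Fin n) (a : R) :
    Matrix (Fin n ⊕ Fin n) (Fin n ⊕ Fin n) R :=
  Matrix.single (Sum.inr i) (Sum.inl j) a -
    Matrix.single (Sum.inr j) (Sum.inl i) ((ρ : ℤ) • σ.bar a)

/-- The Lie algebra `𝔤_{2n,ρ}(R)`: the `k`-Lie subalgebra of `𝔤𝔩_{2n}(R)` generated by
`f_{ij}(a)` for `i ≠ j` and by `g_{ij}(a)`, `h_{ij}(a)` for `i ≤ j`, with `a ∈ R`. -/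
def gLie (σ : AlgInvolution k R) (n : ℕ) (ρ : ℤˣ) :
    LieSubalgebra k (Matrix (Fin n ⊕ Fin n) (Fin n ⊕ Fin n) R) :=
  LieSubalgebra.lieSpan k (Matrix (Fin n ⊕ Fin n) (Fin n ⊕ Fin n) R)
    ({x | ∃ (i j : Fin n) (a : R), i ≠ j ∧ x = fMat σ i j a} ∪
     {x | ∃ (i j : Fin n) (a : R), i ≤ j ∧ x = gMat σ ρ i j a} ∪
     {x | ∃ (i j : Fin n) (a : R), i ≤ j ∧ x = hMat σ ρ i j a})

end UnitaryLie

/-- The generators `t₁, t₁⁻¹, t₂, t₂⁻¹`. -/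
inductive QTorusGen : Type
  | t₁ | t₁inv | t₂ | t₂inv

open FreeAlgebra in
/-- The relations `t₁ t₁⁻¹ = t₁⁻¹ t₁ = 1 = t₂ t₂⁻¹ = t₂⁻¹ t₂` and `t₂ t₁ = q t₁ t₂`. -/
inductive QTorusRel (q : ℤˣ) : FreeAlgebra ℂ QTorusGen → FreeAlgebra ℂ QTorusGen → Prop
  | t₁_mul_inv : QTorusRel q (ι ℂ QTorusGen.t₁ * ι ℂ QTorusGen.t₁inv) 1
  | t₁_inv_mul : QTorusRel q (ι ℂ QTorusGen.t₁inv * ι ℂ QTorusGen.t₁) 1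
  | t₂_mul_inv : QTorusRel q (ι ℂ QTorusGen.t₂ * ι ℂ QTorusGen.t₂inv) 1
  | t₂_inv_mul : QTorusRel q (ι ℂ QTorusGen.t₂inv * ι ℂ QTorusGen.t₂) 1
  | comm : QTorusRel q (ι ℂ QTorusGen.t₂ * ι ℂ QTorusGen.t₁)
      ((q : ℤ) • (ι ℂ QTorusGen.t₁ * ι ℂ QTorusGen.t₂))

/-- The elementary quantum torus `ℂ_q`, `q = ±1`: the unital associative `ℂ`-algebra generated by
`t₁^{±1}, t₂^{±1}` subject to the relations `QTorusRel q`. -/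
def QTorus (q : ℤˣ) : Type := RingQuot (QTorusRel q)

namespace QTorus

instance (q : ℤˣ) : Ring (QTorus q) := inferInstanceAs (Ring (RingQuot (QTorusRel q)))

instance (q : ℤˣ) : Algebra ℂ (QTorus q) := inferInstanceAs (Algebra ℂ (RingQuot (QTorusRel q)))

/-- The image of a generator in `ℂ_q`. -/
def gen (q : ℤˣ) (x : QTorusGen) : QTorus q :=
  RingQuot.mkAlgHom ℂ (QTorusRel q) (FreeAlgebra.ι ℂ x)

theorem t₁_mul_inv (q : ℤˣ) : gen q .t₁ * gen q .t₁inv = 1 := by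
  have := RingQuot.mkAlgHom_rel ℂ (QTorusRel.t₁_mul_inv (q := q))
  rw [map_mul, map_one] at this
  exact this

theorem t₁_inv_mul (q : ℤˣ) : gen q .t₁inv * gen q .t₁ = 1 := by
  have := RingQuot.mkAlgHom_rel ℂ (QTorusRel.t₁_inv_mul (q := q))
  rw [map_mul, map_one] at this
  exact this

theorem t₂_mul_inv (q : ℤˣ) : gen q .t₂ * gen q .t₂inv = 1 := by
  have := RingQuot.mkAlgHom_rel ℂ (QTorusRel.t₂_mul_inv (q := q))
  rw [map_mul, map_one] at this
  exact this

theorem t₂_inv_mul (q : ℤˣ) : gen q .t₂inv * gen q .t₂ = 1 := by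
  have := RingQuot.mkAlgHom_rel ℂ (QTorusRel.t₂_inv_mul (q := q))
  rw [map_mul, map_one] at this
  exact this

theorem t₂_mul_t₁ (q : ℤˣ) : gen q .t₂ * gen q .t₁ = (q : ℤ) • (gen q .t₁ * gen q .t₂) := by
  have := RingQuot.mkAlgHom_rel ℂ (QTorusRel.comm (q := q))
  rw [map_mul, map_zsmul, map_mul] at this
  exact this

/-- The sign by which the involution multiplies a generator: `θ₁` on `t₁^{±1}`,
`θ₂` on `t₂^{±1}`. -/
def genSign (θ₁ θ₂ : ℤˣ) : QTorusGen → ℤˣ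
  | .t₁ => θ₁
  | .t₁inv => θ₁
  | .t₂ => θ₂
  | .t₂inv => θ₂

/-- Two algebra endomorphisms of `ℂ_q` that agree on the generators are equal. -/
theorem algHom_ext {q : ℤˣ} {A : Type*} [Ring A] [Algebra ℂ A] {φ ψ : QTorus q →ₐ[ℂ] A}
    (h : ∀ x, φ (gen q x) = ψ (gen q x)) : φ = ψ := by
  refine RingQuot.ringQuot_ext' (S := ℂ) (s := QTorusRel q) φ ψ ?_
  refine FreeAlgebra.hom_ext ?_
  funext x
  exact h x

/-- The algebra map `ℂ_q → ℂ_qᵒᵖ` with `tᵢ ↦ θᵢ tᵢ`. -/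
def barHom (q θ₁ θ₂ : ℤˣ) : QTorus q →ₐ[ℂ] (QTorus q)ᵐᵒᵖ :=
  RingQuot.liftAlgHom ℂ
    ⟨FreeAlgebra.lift ℂ fun x => MulOpposite.op ((genSign θ₁ θ₂ x : ℤ) • gen q x), by
      intro a b h
      rcases Int.units_eq_one_or θ₁ with rfl | rfl <;>
      rcases Int.units_eq_one_or θ₂ with rfl | rfl <;>
      rcases Int.units_eq_one_or q with rfl | rfl <;>
      cases h <;>
      simp [genSign, ← MulOpposite.op_mul, t₁_mul_inv, t₁_inv_mul, t₂_mul_inv, t₂_inv_mul,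
        t₂_mul_t₁, ← MulOpposite.op_neg]⟩

theorem barHom_gen (q θ₁ θ₂ : ℤˣ) (x : QTorusGen) :
    barHom q θ₁ θ₂ (gen q x) = MulOpposite.op ((genSign θ₁ θ₂ x : ℤ) • gen q x) := by
  refine (RingQuot.liftAlgHom_mkAlgHom_apply ℂ (s := QTorusRel q) _ _ _).trans ?_
  exact FreeAlgebra.lift_ι_apply _ x

/-- The involution of `ℂ_q` with `bar t₁ = θ₁ t₁` and `bar t₂ = θ₂ t₂`. -/
def involution (q θ₁ θ₂ : ℤˣ) : AlgInvolution ℂ (QTorus q) where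
  bar := (MulOpposite.opLinearEquiv ℂ).symm.toLinearMap ∘ₗ (barHom q θ₁ θ₂).toLinearMap
  bar_mul a b := by simp
  bar_bar a := by
    let ψ : QTorus q →ₐ[ℂ] QTorus q :=
      { toFun := fun a => (barHom q θ₁ θ₂ (barHom q θ₁ θ₂ a).unop).unop
        map_one' := by simp
        map_mul' := fun a b => by simp
        map_zero' := by simp
        map_add' := fun a b => by simp
        commutes' := fun c => by simp [MulOpposite.algebraMap_apply] }
    have h : ψ = AlgHom.id ℂ (QTorus q) := by
      refine algHom_ext fun x => ?_
      change (barHom q θ₁ θ₂ (barHom q θ₁ θ₂ (gen q x)).unop).unop = gen q x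
      rw [barHom_gen, MulOpposite.unop_op, map_zsmul, barHom_gen, ← MulOpposite.op_smul,
        MulOpposite.unop_op, smul_smul, ← Units.val_mul, Int.units_mul_self]
      simp
    exact congrArg (fun φ : QTorus q →ₐ[ℂ] QTorus q => φ a) h

theorem involution_t₁ (q θ₁ θ₂ : ℤˣ) :
    (involution q θ₁ θ₂).bar (gen q .t₁) = (θ₁ : ℤ) • gen q .t₁ :=
  congrArg MulOpposite.unop (barHom_gen q θ₁ θ₂ .t₁)

theorem involution_t₂ (q θ₁ θ₂ : ℤˣ) :
    (involution q θ₁ θ₂).bar (gen q .t₂) = (θ₂ : ℤ) • gen q .t₂ :=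
  congrArg MulOpposite.unop (barHom_gen q θ₁ θ₂ .t₂)

end QTorus

/-- The set of the six parameter triples `(q, θ₁, θ₂)`. -/
def paramSet : Set (ℤˣ × ℤˣ × ℤˣ) :=
  {(-1, 1, 1), (-1, 1, -1), (-1, -1, -1), (1, 1, 1), (1, 1, -1), (1, -1, -1)}

/-! Write L for the unitary Lie algebra, K for the annihilator of V, and u_rs(a) for the elementary
skew matrices (`uMat`). L acts on V by trace-free operators (`trace_toEnd_gLie_eq_zero`), so its
image in End V, having a faithful irreducible module, has zero radical. Hence K is semiprime: an
ideal that is abelian modulo K lies in K (`LieModule.le_ker_of_isIrreducible`).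

Since n ≥ 3, an ideal of L is governed by its coefficient ideal I (`coeffIdeal`), a two-sided ideal
of the quantum torus stable under the involution. Semiprimeness passes to I: matrices of L with
entries in I lie in K (`mem_of_entries_mem`), and a central bar-fixed element with a power in I lies
in I (`mem_coeffIdeal_of_pow_mem`). As I contains the kernel of a linear map into End V, the central
units t₁² and t₂² satisfy, modulo I, polynomials with simple nonzero roots
(`exists_finset_aeval_prod_mem`).

Fixing t₁² = s² and t₂² = u² leaves an algebra spanned by 1, t₁, t₂, t₁t₂, whose elements are
detected by the evaluations t₁ ↦ ±s T₁, t₂ ↦ ±u T₂ into one model algebra with involution B: ℂ,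
M₂(ℂ), or ℂ × ℂ with the exchange. By Lagrange interpolation, K contains the intersection of the
kernels of finitely many induced surjections from L to the Lie algebra of B. These kernels are
maximal ideals (`sup_ker_gLieMap_eq_top`), so after discarding redundant ones the Chinese remainder
argument of `LieIdeal.exists_quotient_equiv_directSum` gives L / K as a power of that Lie algebra.

It remains to identify it. For M_m with involution X ↦ C Xᵀ C⁻¹, Cᵀ = θ₁ C, a block-diagonal
conjugation absorbs C and changes ρ to θ₁ρ (`nonempty_gLie_matrix_equiv`); for ℂ × ℂ the first
projection gives the special linear algebra (`nonempty_gLie_exchange_equiv_sl`). -/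

/-! ### Semiprime annihilators and Chinese remaindering for Lie algebras -/

section Abstract

variable {k L : Type*} [Field k] [LieRing L] [LieAlgebra k L]

/-- For an irreducible finite-dimensional module on which `L` acts by trace-free operators, an ideal
which is abelian modulo the annihilator lies in the annihilator. -/
theorem LieModule.le_ker_of_isIrreducible [CharZero k] [IsAlgClosed k] {V : Type*} [AddCommGroup V]
    [Module k V] [LieRingModule L V] [LieModule k L V] [FiniteDimensional k V]
    [LieModule.IsIrreducible k L V]
    (htr : ∀ x : L, LinearMap.trace k V (LieModule.toEnd k L V x) = 0)
    (D : LieIdeal k L) (hD : ∀ x ∈ D, ∀ y ∈ D, ⁅x, y⁆ ∈ LieModule.ker k L V) :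
    D ≤ LieModule.ker k L V := by
  set φ := LieModule.toEnd k L V with hφ
  have hact : ∀ (x : φ.range) (v : V), ⁅x, v⁆ = (x : Module.End k V) v := fun _ _ => rfl
  have : Nontrivial V := LieModule.nontrivial_of_isIrreducible k L V
  have hirr : LieModule.IsIrreducible k φ.range V := by
    refine LieModule.IsIrreducible.mk fun N hN => ?_
    let N' : LieSubmodule k L V :=
      { N.toSubmodule with
        lie_mem := fun {x m} hm => N.lie_mem (x := ⟨φ x, x, rfl⟩) hm }
    have hN' : N' ≠ ⊥ := by
      intro h
      apply hN
      rw [LieSubmodule.eq_bot_iff] at h ⊢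
      exact h
    have := (eq_bot_or_eq_top N').resolve_left hN'
    rw [eq_top_iff]
    intro m _
    have : m ∈ N' := by rw [this]; trivial
    exact this
  have hf : LieModule.IsFaithful k φ.range V := by
    rw [LieModule.isFaithful_iff']
    intro x hx
    ext v
    exact hx v
  -- A faithful irreducible module leaves only scalars as possible radical, and a nonzero scalar has
  -- nonzero trace in characteristic zero.
  have hrad : LieAlgebra.HasTrivialRadical k φ.range := by
    refine LieAlgebra.hasTrivialRadical_of_isIrreducible_of_isFaithful k φ.range V ?_
    rintro ⟨-, x, rfl⟩
    exact htr x
  let D' : LieIdeal k φ.range :=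
    { D.toSubmodule.map (φ.rangeRestrict : L →ₗ[k] φ.range) with
      lie_mem := by
        rintro ⟨-, x, rfl⟩ - ⟨y, hy, rfl⟩
        exact ⟨⁅x, y⁆, lie_mem_right k L D x y hy, LieHom.map_lie φ.rangeRestrict x y⟩ }
  have hab : IsLieAbelian D' := by
    constructor
    rintro ⟨-, x, hx, rfl⟩ ⟨-, y, hy, rfl⟩
    apply Subtype.ext
    apply Subtype.ext
    have := hD x hx y hy
    rw [LieModule.ker, LieHom.mem_ker, LieHom.map_lie] at this
    exact this
  have hbot : D' = ⊥ := (LieAlgebra.hasTrivialRadical_iff_no_abelian_ideals k φ.range).mp hrad D' hab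
  intro x hx
  have hx' : φ.rangeRestrict x ∈ D' := ⟨x, hx, rfl⟩
  rw [hbot, LieSubmodule.mem_bot] at hx'
  exact congrArg Subtype.val hx'

/-- Let `K` be an ideal such that ideals which are abelian modulo `K` lie in `K`. If `K` contains
the intersection of the kernels of finitely many surjections onto `S` with maximal kernels, then
`L ⧸ K` is a direct sum of copies of `S`. -/
theorem LieIdeal.exists_quotient_equiv_directSum {S Ω : Type*} [LieRing S] [LieAlgebra k S]
    (K : LieIdeal k L) (hK : ∀ D : LieIdeal k L, (∀ x ∈ D, ∀ y ∈ D, ⁅x, y⁆ ∈ K) → D ≤ K)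
    (ψ : Ω → L →ₗ⁅k⁆ S) (hsurj : ∀ p, Function.Surjective (ψ p))
    (hmax : ∀ p (J : LieIdeal k L), ¬ J ≤ (ψ p).ker → J ⊔ (ψ p).ker = ⊤)
    (P : Finset Ω) (hP : ∀ x, (∀ p ∈ P, ψ p x = 0) → x ∈ K) :
    ∃ m : ℕ, Nonempty ((L ⧸ K) ≃ₗ⁅k⁆ DirectSum (Fin m) fun _ => S) := by
  classical
  induction P using Finset.strongInduction with
  | H P ih =>
  -- Redundant points are dropped by induction, so P may be taken irredundant: no `N p`, the
  -- intersection of the other kernels, lies in K.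
  by_cases hmin : ∃ p ∈ P, ∀ x, (∀ q ∈ P.erase p, ψ q x = 0) → x ∈ K
  · obtain ⟨p, hp, h⟩ := hmin
    exact ih _ (Finset.erase_ssubset hp) h
  push Not at hmin
  let N : Ω → LieIdeal k L := fun p => ⨅ q ∈ P.erase p, (ψ q).ker
  have hN : ∀ p x, x ∈ N p ↔ ∀ q ∈ P.erase p, ψ q x = 0 := by
    intro p x
    simp [N, LieSubmodule.mem_iInf]
  have hNK : ∀ p ∈ P, ¬ N p ≤ K := by
    intro p hp h
    obtain ⟨x, hx, hxK⟩ := hmin p hp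
    exact hxK (h ((hN p x).2 hx))
  have hNP : ∀ p x, x ∈ N p → ψ p x = 0 → x ∈ K := by
    intro p x hx hpx
    refine hP x fun q hq => ?_
    by_cases hqp : q = p
    · rw [hqp, hpx]
    · exact (hN p x).1 hx q (Finset.mem_erase.2 ⟨hqp, hq⟩)
  -- Otherwise K + ker (ψ p) is everything, so [N p, L] lies in K + (N p ∩ ker (ψ p)), hence in K.
  -- Then `N p` is abelian modulo K and is absorbed by K, against irredundancy.
  have hKM : ∀ p ∈ P, K ≤ (ψ p).ker := by
    intro p hp
    by_contra h
    have htop := hmax p K h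
    refine hNK p hp (hK _ fun x hx y _ => ?_)
    have hy : y ∈ K ⊔ (ψ p).ker := by rw [htop]; trivial
    obtain ⟨a, ha, b, hb, rfl⟩ := (LieSubmodule.mem_sup _ _ _).1 hy
    rw [lie_add]
    refine add_mem (lie_mem_right k L K x a ha) (hNP p _ (lie_mem_left k L _ x b hx) ?_)
    rw [LieHom.map_lie, LieHom.mem_ker.1 hb, lie_zero]
  let m := P.card
  let e : Fin m ≃ P := P.equivFin.symm
  let Ψ₀ : L →ₗ[k] (DirectSum (Fin m) fun _ => S) :=
    (DirectSum.linearEquivFunOnFintype k (Fin m) fun _ => S).symm.toLinearMap ∘ₗ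
      LinearMap.pi fun i => (ψ (e i) : L →ₗ[k] S)
  have hΨ₀ : ∀ x i, Ψ₀ x i = ψ (e i) x := fun x i =>
    congrFun ((DirectSum.linearEquivFunOnFintype k (Fin m) fun _ => S).apply_symm_apply
      fun i => ψ (e i) x) i
  let Ψ : L →ₗ⁅k⁆ (DirectSum (Fin m) fun _ => S) :=
    { Ψ₀ with
      map_lie' := by
        intro x y
        refine DFinsupp.ext fun i => ?_
        refine (hΨ₀ _ i).trans ?_
        rw [LieHom.map_lie]
        refine Eq.trans ?_ (DirectSum.bracket_apply (fun _ => S) (Ψ₀ x) (Ψ₀ y) i).symm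
        exact congrArg₂ _ (hΨ₀ x i).symm (hΨ₀ y i).symm }
  have hΨ : ∀ x i, Ψ x i = ψ (e i) x := hΨ₀
  have hker : Ψ.ker = K := by
    ext x
    rw [LieHom.mem_ker]
    constructor
    · intro h
      refine hP x fun p hp => ?_
      have := hΨ x (e.symm ⟨p, hp⟩)
      rw [h, Equiv.apply_symm_apply] at this
      exact this.symm
    · intro h
      refine DFinsupp.ext fun i => ?_
      rw [hΨ]
      exact LieHom.mem_ker.1 (hKM _ (e i).2 h)
  -- Chinese remainder: maximality makes `N (e i)` comaximal with the i-th kernel, so it maps onto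
  -- the i-th summand while vanishing in all others.
  have hsingle : ∀ (i : Fin m) (s : S), ∃ x, Ψ x = DirectSum.of (fun _ => S) i s := by
    intro i s
    have htop : N (e i) ⊔ (ψ (e i)).ker = ⊤ := by
      refine hmax _ _ fun h => hNK _ (e i).2 fun x hx => hNP _ x hx (LieHom.mem_ker.1 (h hx))
    obtain ⟨y, rfl⟩ := hsurj (e i) s
    have hy : y ∈ N (e i) ⊔ (ψ (e i)).ker := by rw [htop]; trivial
    obtain ⟨a, ha, b, hb, rfl⟩ := (LieSubmodule.mem_sup _ _ _).1 hy
    refine ⟨a, DFinsupp.ext fun j => ?_⟩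
    rw [hΨ, map_add, LieHom.mem_ker.1 hb, add_zero]
    by_cases hij : i = j
    · subst hij
      rw [DirectSum.of_eq_same]
    · rw [DirectSum.of_eq_of_ne _ _ _ (Ne.symm hij)]
      refine (hN _ a).1 ha _ (Finset.mem_erase.2 ⟨fun h => hij ?_, (e j).2⟩)
      exact (e.injective (Subtype.ext h)).symm
  have hΨs : Function.Surjective Ψ := by
    intro y
    induction y using DirectSum.induction_on with
    | zero => exact ⟨0, map_zero _⟩
    | of i s => exact hsingle i s
    | add y z hy hz =>
      obtain ⟨a, rfl⟩ := hy
      obtain ⟨b, rfl⟩ := hz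
      exact ⟨a + b, map_add _ _ _⟩
  refine ⟨m, ?_⟩
  rw [← hker]
  exact ⟨Ψ.quotKerEquivRange.trans
    ((LieEquiv.ofEq Ψ.range ⊤ (by rw [(LieHom.range_eq_top Ψ).2 hΨs])).trans
      LieSubalgebra.topEquiv)⟩

end Abstract

theorem AlgInvolution.bar_one {k R : Type*} [CommRing k] [Ring R] [Algebra k R]
    (σ : AlgInvolution k R) : σ.bar 1 = 1 := by
  have h := σ.bar_mul 1 (σ.bar 1)
  rwa [one_mul, σ.bar_bar, one_mul, eq_comm] at h

/-! ### Indices of the hyperbolic form -/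

section HyperbolicIndex

variable {n : ℕ}

/-- The index in `Fin n` underlying `i` or `n + i`. -/
def hypBase : Fin n ⊕ Fin n → Fin n := Sum.elim id id

/-- The sign `1` for the first `n` indices and `ρ` for the last `n`. -/
def hypSign (ρ : ℤˣ) : Fin n ⊕ Fin n → ℤˣ := Sum.elim (fun _ => 1) (fun _ => ρ)

theorem hypBase_swap (r : Fin n ⊕ Fin n) : hypBase r.swap = hypBase r := by
  cases r <;> rfl

theorem hypSign_swap (ρ : ℤˣ) (r : Fin n ⊕ Fin n) : hypSign ρ r.swap = ρ * hypSign ρ r := by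
  cases r
  · simp [hypSign]
  · simp [hypSign, Int.units_mul_self]

theorem ne_of_hypBase_ne {r s : Fin n ⊕ Fin n} (h : hypBase r ≠ hypBase s) : r ≠ s :=
  fun e => h (by rw [e])

theorem ne_swap_of_hypBase_ne {r s : Fin n ⊕ Fin n} (h : hypBase r ≠ hypBase s) : r ≠ s.swap :=
  fun e => h (by rw [e, hypBase_swap])

theorem ne_swap_self (r : Fin n ⊕ Fin n) : r ≠ r.swap := by
  cases r <;> simp

theorem eq_or_eq_swap_of_hypBase_eq {r s : Fin n ⊕ Fin n} (h : hypBase r = hypBase s) :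
    r = s ∨ r = s.swap := by
  cases r <;> cases s <;> simp_all [hypBase]

theorem swap_ne_swap {r s : Fin n ⊕ Fin n} (h : r ≠ s) : r.swap ≠ s.swap := by
  cases r <;> cases s <;> simp_all

theorem swap_ne_of_ne_swap {r s : Fin n ⊕ Fin n} (h : r ≠ s.swap) : r.swap ≠ s := by
  cases r <;> cases s <;> simp_all

theorem exists_hypBase_ne (hn : 3 ≤ n) (r s : Fin n ⊕ Fin n) :
    ∃ t : Fin n ⊕ Fin n, hypBase t ≠ hypBase r ∧ hypBase t ≠ hypBase s := by
  obtain ⟨i, hi⟩ := Finset.exists_mem_notMem_of_card_lt_card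
    (s := {hypBase r, hypBase s}) (t := (Finset.univ : Finset (Fin n))) (by
      rw [Finset.card_univ, Fintype.card_fin]
      exact lt_of_le_of_lt Finset.card_le_two hn)
  refine ⟨Sum.inl i, ?_⟩
  simpa [hypBase] using hi

end HyperbolicIndex

/-! ### Elementary skew matrices and their brackets -/

section Unitary

variable {k R : Type*} [CommRing k] [Ring R] [Algebra k R]

/-- The matrix `e_{rs}(a) - ε_r ε_s e_{s'r'}(bar a)`, where `r ↦ r'` exchanges `i` and `n + i`. -/
def uMat (σ : AlgInvolution k R) (ρ : ℤˣ) {n : ℕ} (r s : Fin n ⊕ Fin n) :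
    R →ₗ[k] Matrix (Fin n ⊕ Fin n) (Fin n ⊕ Fin n) R :=
  Matrix.singleLinearMap k r s -
    ((hypSign ρ r * hypSign ρ s : ℤˣ) : ℤ) • Matrix.singleLinearMap k s.swap r.swap ∘ₗ σ.bar

variable (σ : AlgInvolution k R) (ρ : ℤˣ) {n : ℕ}

theorem uMat_apply (r s : Fin n ⊕ Fin n) (a : R) : uMat σ ρ r s a = Matrix.single r s a -
    Matrix.single s.swap r.swap (((hypSign ρ r * hypSign ρ s : ℤˣ) : ℤ) • σ.bar a) := by
  simp [uMat, Matrix.singleLinearMap, Matrix.smul_single]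

theorem fMat_eq_uMat (i j : Fin n) (a : R) : fMat σ i j a = uMat σ ρ (.inl i) (.inl j) a := by
  simp [fMat, uMat_apply, hypSign]

theorem gMat_eq_uMat (i j : Fin n) (a : R) : gMat σ ρ i j a = uMat σ ρ (.inl i) (.inr j) a := by
  simp [gMat, uMat_apply, hypSign]

theorem hMat_eq_uMat (i j : Fin n) (a : R) : hMat σ ρ i j a = uMat σ ρ (.inr i) (.inl j) a := by
  simp [hMat, uMat_apply, hypSign]

/-- The two matrix units in `uMat` are interchanged by the hyperbolic involution; this redundancy is
what lets the generators with i ≤ j account for every off-diagonal pair. -/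
theorem uMat_swap (r s : Fin n ⊕ Fin n) (a : R) : uMat σ ρ s.swap r.swap (σ.bar a) =
    -(((hypSign ρ r * hypSign ρ s : ℤˣ) : ℤ) • uMat σ ρ r s a) := by
  rw [uMat_apply, uMat_apply, hypSign_swap, hypSign_swap]
  rcases Int.units_eq_one_or (hypSign ρ r) with hr | hr <;>
  rcases Int.units_eq_one_or (hypSign ρ s) with hs | hs <;>
  rcases Int.units_eq_one_or ρ with rfl | rfl <;>
  simp [hr, hs, σ.bar_bar, ← Matrix.single_neg]

/-- Of the eight products of matrix units, two always survive and give the right side. The three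
inequalities are exactly what kills the other six. -/
theorem uMat_lie_uMat {r s t : Fin n ⊕ Fin n} (hrt : r ≠ t) (hst : s ≠ t.swap) (hrs : r ≠ s.swap)
    (a b : R) : ⁅uMat σ ρ r s a, uMat σ ρ s t b⁆ = uMat σ ρ r t (a * b) := by
  rw [Ring.lie_def, uMat_apply, uMat_apply, uMat_apply]
  simp only [sub_mul, mul_sub, Matrix.single_mul_single_same,
    Matrix.single_mul_single_of_ne _ _ _ _ hrt.symm,
    Matrix.single_mul_single_of_ne _ _ _ _ (swap_ne_swap hrt),
    Matrix.single_mul_single_of_ne _ _ _ _ hst,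
    Matrix.single_mul_single_of_ne _ _ _ _ (swap_ne_of_ne_swap hst).symm,
    Matrix.single_mul_single_of_ne _ _ _ _ hrs.symm,
    Matrix.single_mul_single_of_ne _ _ _ _ (swap_ne_of_ne_swap hrs), σ.bar_mul]
  rcases Int.units_eq_one_or (hypSign ρ r) with hr | hr <;>
  rcases Int.units_eq_one_or (hypSign ρ s) with hs | hs <;>
  rcases Int.units_eq_one_or (hypSign ρ t) with ht | ht <;>
  simp [hr, hs, ht, ← Matrix.single_neg]

theorem uMat_lie_uMat_self {r s : Fin n ⊕ Fin n} (h : hypBase r ≠ hypBase s) (a b : R) :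
    ⁅uMat σ ρ r s a, uMat σ ρ s r b⁆ = uMat σ ρ r r (a * b) - uMat σ ρ s s (b * a) := by
  have h1 := ne_swap_of_hypBase_ne h
  have h2 := ne_swap_of_hypBase_ne h.symm
  rw [Ring.lie_def, uMat_apply, uMat_apply, uMat_apply, uMat_apply]
  simp only [sub_mul, mul_sub, Matrix.single_mul_single_same,
    Matrix.single_mul_single_of_ne _ _ _ _ h1, Matrix.single_mul_single_of_ne _ _ _ _ h2,
    Matrix.single_mul_single_of_ne _ _ _ _ h1.symm,
    Matrix.single_mul_single_of_ne _ _ _ _ h2.symm, σ.bar_mul]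
  rcases Int.units_eq_one_or (hypSign ρ r) with hr | hr <;>
  rcases Int.units_eq_one_or (hypSign ρ s) with hs | hs <;>
  simp [hr, hs] <;> abel

/-- The Lie algebra of matrices which are skew for the hyperbolic involution
`X ↦ (ε_r ε_s bar X_{s'r'})_{r,s}`. -/
def skewLie (n : ℕ) : LieSubalgebra k (Matrix (Fin n ⊕ Fin n) (Fin n ⊕ Fin n) R) where
  carrier := {X | ∀ r s, X s.swap r.swap =
    -(((hypSign ρ r * hypSign ρ s : ℤˣ) : ℤ) • σ.bar (X r s))}
  zero_mem' r s := by simp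
  add_mem' {X Y} hX hY r s := by
    simp only [Matrix.add_apply, hX r s, hY r s, map_add, smul_add, neg_add]
  smul_mem' c X hX r s := by
    simp only [Matrix.smul_apply, hX r s, map_smul, smul_neg, smul_comm c]
  lie_mem' {X Y} hX hY := by
    have key : ∀ {X Y : Matrix (Fin n ⊕ Fin n) (Fin n ⊕ Fin n) R},
        (∀ r s, X s.swap r.swap = -(((hypSign ρ r * hypSign ρ s : ℤˣ) : ℤ) • σ.bar (X r s))) →
        (∀ r s, Y s.swap r.swap = -(((hypSign ρ r * hypSign ρ s : ℤˣ) : ℤ) • σ.bar (Y r s))) →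
        ∀ r s, (X * Y) s.swap r.swap =
          ((hypSign ρ r * hypSign ρ s : ℤˣ) : ℤ) • σ.bar ((Y * X) r s) := by
      intro X Y hX hY r s
      rw [Matrix.mul_apply, Matrix.mul_apply, map_sum, Finset.smul_sum,
        ← Equiv.sum_comp (Equiv.sumComm (Fin n) (Fin n))]
      refine Finset.sum_congr rfl fun t _ => ?_
      rw [Equiv.sumComm_apply, hX, hY, σ.bar_mul, neg_mul_neg, smul_mul_smul_comm]
      rcases Int.units_eq_one_or (hypSign ρ t) with ht | ht <;> simp [ht, mul_comm]
    intro r s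
    rw [Ring.lie_def, Matrix.sub_apply, Matrix.sub_apply, key hX hY, key hY hX, map_sub, smul_sub]
    abel

/-- By skewness each u_rs(X r s) carries the entries of X at (r, s) and at (s', r'), so the sum
counts every entry twice. -/
theorem two_smul_eq_sum_uMat {X : Matrix (Fin n ⊕ Fin n) (Fin n ⊕ Fin n) R}
    (hX : X ∈ skewLie σ ρ n) : (2 : ℕ) • X = ∑ r, ∑ s, uMat σ ρ r s (X r s) := by
  have h : ∀ r s, uMat σ ρ r s (X r s) =
      Matrix.single r s (X r s) + Matrix.single s.swap r.swap (X s.swap r.swap) := by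
    intro r s
    rw [uMat_apply, hX r s, ← Matrix.single_neg, sub_eq_add_neg]
  simp only [h, Finset.sum_add_distrib]
  rw [two_nsmul, ← Matrix.matrix_eq_sum_single]
  congr 1
  conv_lhs => rw [Matrix.matrix_eq_sum_single X, Finset.sum_comm]
  rw [← Equiv.sum_comp (Equiv.sumComm (Fin n) (Fin n))]
  refine Finset.sum_congr rfl fun r _ => ?_
  rw [← Equiv.sum_comp (Equiv.sumComm (Fin n) (Fin n))]
  rfl

theorem uMat_mem_skewLie (r s : Fin n ⊕ Fin n) (a : R) : uMat σ ρ r s a ∈ skewLie σ ρ n := by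
  intro p q
  have hz : ∀ {z : ℤ} {p q r s : Fin n ⊕ Fin n} {a : R},
      z • σ.bar (Matrix.single p q a r s) = Matrix.single p q (z • σ.bar a) r s := by
    intro z p q r s a
    simp only [Matrix.single_apply]
    split_ifs <;> simp
  have hs : ∀ {p q r s : Fin n ⊕ Fin n} {a : R}, Matrix.single p q a s.swap r.swap =
      Matrix.single q.swap p.swap a r s := by
    intro p q r s a
    simp only [Matrix.single_apply]
    refine if_congr ?_ rfl rfl
    constructor
    · rintro ⟨rfl, rfl⟩
      simp
    · rintro ⟨rfl, rfl⟩
      simp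
  rw [uMat_apply, Matrix.sub_apply, Matrix.sub_apply, hs, hs, map_sub, smul_sub, hz, hz,
    Sum.swap_swap, Sum.swap_swap]
  by_cases h1 : r = p ∧ s = q
  · obtain ⟨rfl, rfl⟩ := h1
    rcases Int.units_eq_one_or (hypSign ρ r) with hr | hr <;>
    rcases Int.units_eq_one_or (hypSign ρ s) with hs | hs <;>
    simp [hr, hs, σ.bar_bar]
  by_cases h2 : s.swap = p ∧ r.swap = q
  · obtain ⟨rfl, rfl⟩ := h2
    rcases Int.units_eq_one_or (hypSign ρ r) with hr | hr <;>
    rcases Int.units_eq_one_or (hypSign ρ s) with hs | hs <;>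
    rcases Int.units_eq_one_or ρ with rfl | rfl <;>
    simp [hypSign_swap, hr, hs, σ.bar_bar]
  simp [h1, h2]

theorem uMat_mem_gLie {r s : Fin n ⊕ Fin n} (h : r ≠ s) (a : R) :
    uMat σ ρ r s a ∈ gLie σ n ρ := by
  have hswap : ∀ r s : Fin n ⊕ Fin n, (∀ a, uMat σ ρ r s a ∈ gLie σ n ρ) →
      ∀ a, uMat σ ρ s.swap r.swap a ∈ gLie σ n ρ := by
    intro r s h a
    rw [← σ.bar_bar a, uMat_swap]
    exact neg_mem (zsmul_mem (h _) _)
  have hll : ∀ i j : Fin n, i ≠ j → ∀ a, uMat σ ρ (.inl i) (.inl j) a ∈ gLie σ n ρ :=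
    fun i j hij a => LieSubalgebra.subset_lieSpan
      (Or.inl (Or.inl ⟨i, j, a, hij, (fMat_eq_uMat σ ρ i j a).symm⟩))
  have hlr : ∀ i j : Fin n, i ≤ j → ∀ a, uMat σ ρ (.inl i) (.inr j) a ∈ gLie σ n ρ :=
    fun i j hij a => LieSubalgebra.subset_lieSpan
      (Or.inl (Or.inr ⟨i, j, a, hij, (gMat_eq_uMat σ ρ i j a).symm⟩))
  have hrl : ∀ i j : Fin n, i ≤ j → ∀ a, uMat σ ρ (.inr i) (.inl j) a ∈ gLie σ n ρ :=
    fun i j hij a => LieSubalgebra.subset_lieSpan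
      (Or.inr ⟨i, j, a, hij, (hMat_eq_uMat σ ρ i j a).symm⟩)
  rcases r with i | i <;> rcases s with j | j
  · exact hll i j (fun e => h (by rw [e])) a
  · rcases le_total i j with hij | hij
    · exact hlr i j hij a
    · exact hswap _ _ (hlr j i hij) a
  · rcases le_total i j with hij | hij
    · exact hrl i j hij a
    · exact hswap _ _ (hrl j i hij) a
  · exact hswap _ _ (hll j i fun e => h (by rw [e])) a

theorem gLie_le {L : LieSubalgebra k (Matrix (Fin n ⊕ Fin n) (Fin n ⊕ Fin n) R)}
    (h : ∀ r s a, r ≠ s → uMat σ ρ r s a ∈ L) : gLie σ n ρ ≤ L := by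
  refine LieSubalgebra.lieSpan_le.2 ?_
  rintro x ((⟨i, j, a, hij, rfl⟩ | ⟨i, j, a, hij, rfl⟩) | ⟨i, j, a, hij, rfl⟩)
  · rw [fMat_eq_uMat σ ρ]
    exact h _ _ _ fun e => hij (Sum.inl_injective e)
  · rw [gMat_eq_uMat σ ρ]
    exact h _ _ _ (by simp)
  · rw [hMat_eq_uMat σ ρ]
    exact h _ _ _ (by simp)

theorem gLie_le_skewLie : gLie σ n ρ ≤ skewLie σ ρ n :=
  gLie_le σ ρ fun r s a _ => uMat_mem_skewLie σ ρ r s a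

/-- The brackets [u_rs(a), u_sr(b)] and [u_rs(ba), u_sr(1)] have the same u_ss part, which cancels
in their difference. -/
theorem uMat_self_bracket_mem_gLie (hn : 3 ≤ n) (r : Fin n ⊕ Fin n) (a b : R) :
    uMat σ ρ r r (a * b - b * a) ∈ gLie σ n ρ := by
  obtain ⟨s, hs, -⟩ := exists_hypBase_ne hn r r
  have h1 := (gLie σ n ρ).lie_mem (uMat_mem_gLie σ ρ (ne_of_hypBase_ne hs.symm) a)
    (uMat_mem_gLie σ ρ (ne_of_hypBase_ne hs) b)
  have h2 := (gLie σ n ρ).lie_mem (uMat_mem_gLie σ ρ (ne_of_hypBase_ne hs.symm) (b * a))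
    (uMat_mem_gLie σ ρ (ne_of_hypBase_ne hs) 1)
  rw [uMat_lie_uMat_self _ _ hs.symm] at h1 h2
  rw [one_mul, mul_one] at h2
  have := sub_mem h1 h2
  rwa [sub_sub_sub_cancel_right, ← map_sub] at this

/-- Bracketing through s and through its partner s' gives s-parts that cancel, because u_{s's'}(a) =
-u_ss(bar a). -/
theorem uMat_self_add_bar_mem_gLie (hn : 3 ≤ n) (r : Fin n ⊕ Fin n) (a : R) :
    uMat σ ρ r r (a + σ.bar a) ∈ gLie σ n ρ := by
  obtain ⟨s, hs, -⟩ := exists_hypBase_ne hn r r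
  have hs' : hypBase s.swap ≠ hypBase r := by rwa [hypBase_swap]
  have h1 := (gLie σ n ρ).lie_mem (uMat_mem_gLie σ ρ (ne_of_hypBase_ne hs.symm) (σ.bar a))
    (uMat_mem_gLie σ ρ (ne_of_hypBase_ne hs) 1)
  have h2 := (gLie σ n ρ).lie_mem (uMat_mem_gLie σ ρ (ne_of_hypBase_ne hs'.symm) a)
    (uMat_mem_gLie σ ρ (ne_of_hypBase_ne hs') 1)
  rw [uMat_lie_uMat_self _ _ hs.symm, one_mul, mul_one] at h1
  rw [uMat_lie_uMat_self _ _ hs'.symm, one_mul, mul_one] at h2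
  have h3 : uMat σ ρ s.swap s.swap a = -uMat σ ρ s s (σ.bar a) := by
    have := uMat_swap σ ρ s s (σ.bar a)
    rw [σ.bar_bar, Int.units_mul_self] at this
    simpa using this
  rw [h3] at h2
  have := add_mem h1 h2
  rw [map_add]
  convert this using 1
  abel

end Unitary

/-- `K` is an ideal of the Lie subalgebra `L`. -/
structure IsLieIdealIn {k A : Type*} [CommRing k] [LieRing A] [LieAlgebra k A]
    (L : LieSubalgebra k A) (K : Submodule k A) : Prop where
  le : ∀ x ∈ K, x ∈ L
  lie_mem : ∀ x ∈ L, ∀ y ∈ K, ⁅x, y⁆ ∈ K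

theorem IsLieIdealIn.lie_mem_left {k A : Type*} [CommRing k] [LieRing A] [LieAlgebra k A]
    {L : LieSubalgebra k A} {K : Submodule k A} (hK : IsLieIdealIn L K) {x y : A} (hx : x ∈ K)
    (hy : y ∈ L) : ⁅x, y⁆ ∈ K := by
  rw [← lie_skew]
  exact neg_mem (hK.lie_mem y hy x hx)

/-! ### The coefficient ideal of an ideal -/

section CoeffIdeal

variable {k R : Type*} [CommRing k] [Ring R] [Algebra k R] {σ : AlgInvolution k R} {ρ : ℤˣ} {n : ℕ}
  {K : Submodule k (Matrix (Fin n ⊕ Fin n) (Fin n ⊕ Fin n) R)}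

variable (σ ρ K) in
/-- The set of `a` such that `u_{rs}(a) ∈ K` for all `r`, `s` with distinct underlying indices. -/
def coeffIdeal : Submodule k R where
  carrier := {a | ∀ r s, hypBase r ≠ hypBase s → uMat σ ρ r s a ∈ K}
  zero_mem' r s _ := by rw [map_zero]; exact zero_mem K
  add_mem' ha hb r s h := by rw [map_add]; exact add_mem (ha r s h) (hb r s h)
  smul_mem' c a ha r s h := by rw [map_smul]; exact K.smul_mem c (ha r s h)

theorem uMat_mul_mem_right (hK : IsLieIdealIn (gLie σ n ρ) K) {r s t : Fin n ⊕ Fin n}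
    (hrs : hypBase r ≠ hypBase s) (hrt : hypBase r ≠ hypBase t) (hst : hypBase s ≠ hypBase t)
    {a : R} (ha : uMat σ ρ r s a ∈ K) (b : R) : uMat σ ρ r t (a * b) ∈ K := by
  rw [← uMat_lie_uMat σ ρ (ne_of_hypBase_ne hrt) (ne_swap_of_hypBase_ne hst)
    (ne_swap_of_hypBase_ne hrs)]
  exact hK.lie_mem_left ha (uMat_mem_gLie σ ρ (ne_of_hypBase_ne hst) b)

theorem uMat_mul_mem_left (hK : IsLieIdealIn (gLie σ n ρ) K) {r s t : Fin n ⊕ Fin n}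
    (hrs : hypBase r ≠ hypBase s) (hrt : hypBase r ≠ hypBase t) (hst : hypBase s ≠ hypBase t)
    {a : R} (ha : uMat σ ρ s t a ∈ K) (b : R) : uMat σ ρ r t (b * a) ∈ K := by
  rw [← uMat_lie_uMat σ ρ (ne_of_hypBase_ne hrt) (ne_swap_of_hypBase_ne hst)
    (ne_swap_of_hypBase_ne hrs)]
  exact hK.lie_mem _ (uMat_mem_gLie σ ρ (ne_of_hypBase_ne hrs) b) _ ha

/-- One position suffices: bracketing with u(1) moves the column or the row. When old and new index
share the same base, the move goes through a third one, which exists since n ≥ 3. -/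
theorem mem_coeffIdeal_of_uMat_mem (hn : 3 ≤ n) (hK : IsLieIdealIn (gLie σ n ρ) K)
    {r s : Fin n ⊕ Fin n} (hrs : hypBase r ≠ hypBase s) {a : R} (ha : uMat σ ρ r s a ∈ K) :
    a ∈ coeffIdeal σ ρ K := by
  have hcol : ∀ r s t, hypBase r ≠ hypBase s → hypBase r ≠ hypBase t → uMat σ ρ r s a ∈ K →
      uMat σ ρ r t a ∈ K := by
    intro r s t hrs hrt h
    obtain ⟨p, hp, hp'⟩ := exists_hypBase_ne hn r s
    by_cases hst : hypBase s = hypBase t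
    · have h1 := uMat_mul_mem_right hK hrs hp.symm hp'.symm h 1
      have h2 := uMat_mul_mem_right hK hp.symm hrt (by rwa [← hst]) h1 1
      rwa [mul_one, mul_one] at h2
    · have h1 := uMat_mul_mem_right hK hrs hrt hst h 1
      rwa [mul_one] at h1
  have hrow : ∀ r s t, hypBase r ≠ hypBase s → hypBase t ≠ hypBase s → uMat σ ρ r s a ∈ K →
      uMat σ ρ t s a ∈ K := by
    intro r s t hrs hts h
    obtain ⟨p, hp, hp'⟩ := exists_hypBase_ne hn r s
    by_cases hrt : hypBase r = hypBase t
    · have h1 := uMat_mul_mem_left hK hp hp' hrs h 1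
      have h2 := uMat_mul_mem_left hK (r := t) (by rw [← hrt]; exact hp.symm) hts hp' h1 1
      rwa [one_mul, one_mul] at h2
    · have h1 := uMat_mul_mem_left hK (Ne.symm hrt) hts hrs h 1
      rwa [one_mul] at h1
  intro p q hpq
  obtain ⟨t, htr, htp⟩ := exists_hypBase_ne hn r p
  exact hcol p t q htp.symm hpq (hrow r t p htr.symm htp.symm (hcol r s t hrs htr.symm ha))

theorem exists_three (hn : 3 ≤ n) : ∃ r s t : Fin n ⊕ Fin n,
    hypBase r ≠ hypBase s ∧ hypBase r ≠ hypBase t ∧ hypBase s ≠ hypBase t := by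
  let r : Fin n ⊕ Fin n := .inl ⟨0, by omega⟩
  obtain ⟨s, hs, -⟩ := exists_hypBase_ne hn r r
  obtain ⟨t, ht, ht'⟩ := exists_hypBase_ne hn r s
  exact ⟨r, s, t, hs.symm, ht.symm, ht'.symm⟩

theorem mul_mem_coeffIdeal_right (hn : 3 ≤ n) (hK : IsLieIdealIn (gLie σ n ρ) K) {a : R}
    (ha : a ∈ coeffIdeal σ ρ K) (b : R) : a * b ∈ coeffIdeal σ ρ K := by
  obtain ⟨r, s, t, hrs, hrt, hst⟩ := exists_three hn
  exact mem_coeffIdeal_of_uMat_mem hn hK hrt (uMat_mul_mem_right hK hrs hrt hst (ha r s hrs) b)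

theorem mul_mem_coeffIdeal_left (hn : 3 ≤ n) (hK : IsLieIdealIn (gLie σ n ρ) K) {a : R}
    (ha : a ∈ coeffIdeal σ ρ K) (b : R) : b * a ∈ coeffIdeal σ ρ K := by
  obtain ⟨r, s, t, hrs, hrt, hst⟩ := exists_three hn
  exact mem_coeffIdeal_of_uMat_mem hn hK hrt (uMat_mul_mem_left hK hrs hrt hst (ha s t hst) b)

theorem bar_mem_coeffIdeal (hn : 3 ≤ n) (hK : IsLieIdealIn (gLie σ n ρ) K) {a : R}
    (ha : a ∈ coeffIdeal σ ρ K) : σ.bar a ∈ coeffIdeal σ ρ K := by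
  obtain ⟨r, s, -, hrs, -, -⟩ := exists_three hn
  refine mem_coeffIdeal_of_uMat_mem hn hK (r := s.swap) (s := r.swap) ?_ ?_
  · rw [hypBase_swap, hypBase_swap]
    exact hrs.symm
  · rw [uMat_swap]
    exact neg_mem (zsmul_mem (ha r s hrs) _)

/-- The only positions not covered by the definition are (s', s), and u_{s's}(a) = [u_{s't}(1),
u_ts(a)] for a third index t. -/
theorem uMat_mem_of_mem_coeffIdeal (hn : 3 ≤ n) (hK : IsLieIdealIn (gLie σ n ρ) K) {a : R}
    (ha : a ∈ coeffIdeal σ ρ K) {r s : Fin n ⊕ Fin n} (hrs : r ≠ s) : uMat σ ρ r s a ∈ K := by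
  by_cases h : hypBase r = hypBase s
  · obtain rfl : r = s.swap := (eq_or_eq_swap_of_hypBase_eq h).resolve_left hrs
    obtain ⟨t, ht, -⟩ := exists_hypBase_ne hn s s
    have ht' : hypBase t ≠ hypBase s.swap := by rwa [hypBase_swap]
    rw [← one_mul a, ← uMat_lie_uMat σ ρ hrs (ne_swap_of_hypBase_ne ht)
      (ne_swap_of_hypBase_ne ht'.symm)]
    exact hK.lie_mem _ (uMat_mem_gLie σ ρ (ne_of_hypBase_ne ht'.symm) 1) _ (ha t s ht)
  · exact ha r s h

theorem uMat_self_bracket_mem (hn : 3 ≤ n) (hK : IsLieIdealIn (gLie σ n ρ) K) {a : R}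
    (ha : a ∈ coeffIdeal σ ρ K) (r : Fin n ⊕ Fin n) (b : R) :
    uMat σ ρ r r (a * b - b * a) ∈ K := by
  obtain ⟨s, hs, -⟩ := exists_hypBase_ne hn r r
  have h1 := hK.lie_mem_left (ha r s hs.symm) (uMat_mem_gLie σ ρ (ne_of_hypBase_ne hs) b)
  have h2 := hK.lie_mem_left (mul_mem_coeffIdeal_left hn hK ha b r s hs.symm)
    (uMat_mem_gLie σ ρ (ne_of_hypBase_ne hs) 1)
  rw [uMat_lie_uMat_self _ _ hs.symm] at h1 h2
  rw [one_mul, mul_one] at h2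
  have := sub_mem h1 h2
  rwa [sub_sub_sub_cancel_right, ← map_sub] at this

/-- An ideal of `𝔤_{2n,ρ}(R)` with coefficient ideal `R` is everything. -/
theorem gLie_le_of_one_mem (hn : 3 ≤ n) (hK : IsLieIdealIn (gLie σ n ρ) K)
    (h : (1 : R) ∈ coeffIdeal σ ρ K) {x : Matrix (Fin n ⊕ Fin n) (Fin n ⊕ Fin n) R}
    (hx : x ∈ gLie σ n ρ) : x ∈ K := by
  let L : LieSubalgebra k (Matrix (Fin n ⊕ Fin n) (Fin n ⊕ Fin n) R) :=
    { K with lie_mem' := fun {x y} hx hy => hK.lie_mem x (hK.le x hx) y hy }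
  refine gLie_le σ ρ (L := L) (fun r s a hrs => uMat_mem_of_mem_coeffIdeal hn hK ?_ hrs) hx
  simpa using mul_mem_coeffIdeal_right hn hK h a

end CoeffIdeal

/-- The weight of the `p`-th basis vector under `u_{rr}(1)`. -/
def hypWeight (k : Type*) [Field k] {n : ℕ} (r p : Fin n ⊕ Fin n) : k :=
  if p = r then 1 else if p = r.swap then -1 else 0

theorem uMat_one_eq_diagonal {k R : Type*} [Field k] [Ring R] [Algebra k R] (σ : AlgInvolution k R)
    (ρ : ℤˣ) {n : ℕ} (r : Fin n ⊕ Fin n) :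
    uMat σ ρ r r 1 = Matrix.diagonal fun p => algebraMap k R (hypWeight k r p) := by
  ext p q
  rw [uMat_apply, Int.units_mul_self, σ.bar_one, Units.val_one, one_smul, Matrix.sub_apply]
  by_cases hpq : p = q
  · subst hpq
    rw [Matrix.diagonal_apply_eq]
    by_cases h1 : p = r
    · subst h1
      simp [hypWeight, (ne_swap_self p).symm]
    · by_cases h2 : p = r.swap
      · subst h2
        simp [hypWeight, ne_swap_self r, (ne_swap_self r).symm]
      · simp [hypWeight, h1, h2, Ne.symm h1, Ne.symm h2]
  · rw [Matrix.diagonal_apply_ne _ hpq, Matrix.single_apply_of_ne, Matrix.single_apply_of_ne,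
      sub_zero]
    · rintro ⟨rfl, rfl⟩
      exact hpq rfl
    · rintro ⟨rfl, rfl⟩
      exact hpq rfl

/-! ### Weight projections and the entries of an ideal -/

section Field

variable {k R : Type*} [Field k] [CharZero k] [Ring R] [Algebra k R] {σ : AlgInvolution k R}
  {ρ : ℤˣ} {n : ℕ} {K : Submodule k (Matrix (Fin n ⊕ Fin n) (Fin n ⊕ Fin n) R)}

theorem mem_of_two_nsmul_mem {M : Type*} [AddCommGroup M] [Module k M] (K : Submodule k M) {x : M}
    (h : (2 : ℕ) • x ∈ K) : x ∈ K := by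
  rw [← Nat.cast_smul_eq_nsmul k] at h
  exact (K.smul_mem_iff (by norm_num)).1 h

theorem sub_diagonal_mem (hn : 3 ≤ n) (hK : IsLieIdealIn (gLie σ n ρ) K)
    {X : Matrix (Fin n ⊕ Fin n) (Fin n ⊕ Fin n) R} (hX : X ∈ skewLie σ ρ n)
    (h : ∀ r s, r ≠ s → X r s ∈ coeffIdeal σ ρ K) :
    X - Matrix.diagonal (fun r => X r r) ∈ K := by
  have hY : X - Matrix.diagonal (fun r => X r r) ∈ skewLie σ ρ n := by
    refine sub_mem hX fun r s => ?_
    by_cases hrs : r = s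
    · subst hrs
      rw [Matrix.diagonal_apply_eq, Matrix.diagonal_apply_eq]
      exact hX r r
    · rw [Matrix.diagonal_apply_ne _ hrs, Matrix.diagonal_apply_ne _ (swap_ne_swap (Ne.symm hrs))]
      simp
  refine mem_of_two_nsmul_mem K ?_
  rw [two_smul_eq_sum_uMat σ ρ hY]
  refine sum_mem fun r _ => sum_mem fun s _ => ?_
  by_cases hrs : r = s
  · subst hrs
    simp
  · rw [Matrix.sub_apply, Matrix.diagonal_apply_ne _ hrs, sub_zero]
    exact uMat_mem_of_mem_coeffIdeal hn hK (h r s hrs) hrs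

/-- Elements of `𝔤_{2n,ρ}(R)` with entries in the coefficient ideal of `K` commute modulo `K`. -/
theorem lie_mem_of_entries_mem (hn : 3 ≤ n) (hK : IsLieIdealIn (gLie σ n ρ) K)
    {X Y : Matrix (Fin n ⊕ Fin n) (Fin n ⊕ Fin n) R} (hX : X ∈ gLie σ n ρ) (hY : Y ∈ gLie σ n ρ)
    (hXI : ∀ r s, X r s ∈ coeffIdeal σ ρ K) (hYI : ∀ r s, Y r s ∈ coeffIdeal σ ρ K) :
    ⁅X, Y⁆ ∈ K := by
  set X' := Matrix.diagonal (fun r => X r r) with hX'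
  set Y' := Matrix.diagonal (fun r => Y r r) with hY'
  have hXK : X - X' ∈ K := sub_diagonal_mem hn hK (gLie_le_skewLie σ ρ hX) fun r s _ => hXI r s
  have hYK : Y - Y' ∈ K := sub_diagonal_mem hn hK (gLie_le_skewLie σ ρ hY) fun r s _ => hYI r s
  have hX'L : X' ∈ gLie σ n ρ := by
    have := sub_mem hX (hK.le _ hXK)
    rwa [sub_sub_cancel] at this
  have hY'L : Y' ∈ gLie σ n ρ := by
    have := sub_mem hY (hK.le _ hYK)
    rwa [sub_sub_cancel] at this
  have hlie : ⁅X', Y'⁆ = Matrix.diagonal fun r => X r r * Y r r - Y r r * X r r := by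
    rw [Ring.lie_def, hX', hY', Matrix.diagonal_mul_diagonal, Matrix.diagonal_mul_diagonal,
      Matrix.diagonal_sub]
  -- The diagonal parts themselves need not lie in K, but their bracket has commutators ab - ba with
  -- a in the coefficient ideal on its diagonal, and u_rr of such an element does lie in K.
  have hdiag : ⁅X', Y'⁆ ∈ K := by
    refine mem_of_two_nsmul_mem K ?_
    rw [two_smul_eq_sum_uMat σ ρ (gLie_le_skewLie σ ρ ((gLie σ n ρ).lie_mem hX'L hY'L)), hlie]
    refine sum_mem fun r _ => sum_mem fun s _ => ?_
    by_cases hrs : r = s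
    · subst hrs
      rw [Matrix.diagonal_apply_eq]
      exact uMat_self_bracket_mem hn hK (hXI r r) r _
    · rw [Matrix.diagonal_apply_ne _ hrs, map_zero]
      exact zero_mem K
  have h : ⁅X, Y⁆ = ⁅X - X', Y⁆ + (⁅X', Y - Y'⁆ + ⁅X', Y'⁆) := by
    rw [← lie_add, sub_add_cancel, ← add_lie, sub_add_cancel]
  rw [h]
  exact add_mem (hK.lie_mem_left hXK hY) (add_mem (hK.lie_mem _ hX'L _ hYK) hdiag)

theorem uMat_self_one_mem_gLie (hn : 3 ≤ n) (r : Fin n ⊕ Fin n) :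
    uMat σ ρ r r 1 ∈ gLie σ n ρ := by
  refine mem_of_two_nsmul_mem (k := k) (gLie σ n ρ).toSubmodule ?_
  have := uMat_self_add_bar_mem_gLie σ ρ hn r 1
  rwa [σ.bar_one, map_add, ← two_nsmul] at this

/-- This is ad u_rr(1) - c, which acts on each matrix position by a scalar; products of such
operators isolate weight spaces. -/
theorem weight_shift_mem (hn : 3 ≤ n) (hK : IsLieIdealIn (gLie σ n ρ) K)
    {X : Matrix (Fin n ⊕ Fin n) (Fin n ⊕ Fin n) R} (hX : X ∈ K) (r : Fin n ⊕ Fin n) (c : k) :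
    (Matrix.of fun p q => (hypWeight k r p - hypWeight k r q - c) • X p q) ∈ K := by
  have h := sub_mem (hK.lie_mem _ (uMat_self_one_mem_gLie hn r) X hX) (K.smul_mem c hX)
  convert h using 1
  ext p q
  rw [Matrix.sub_apply, uMat_one_eq_diagonal, Ring.lie_def, Matrix.sub_apply, Matrix.diagonal_mul,
    Matrix.mul_diagonal, Matrix.smul_apply, Matrix.of_apply, sub_smul, sub_smul, Algebra.smul_def,
    Algebra.smul_def, Algebra.commutes (hypWeight k r q)]

/-- The entries of an ideal at positions with distinct underlying indices lie in its coefficient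
ideal. -/
theorem entry_mem_coeffIdeal (hn : 3 ≤ n) (hK : IsLieIdealIn (gLie σ n ρ) K)
    {X : Matrix (Fin n ⊕ Fin n) (Fin n ⊕ Fin n) R} (hX : X ∈ K) {r s : Fin n ⊕ Fin n}
    (hrs : hypBase r ≠ hypBase s) : X r s ∈ coeffIdeal σ ρ K := by
  refine mem_coeffIdeal_of_uMat_mem hn hK hrs ?_
  -- The ad-weights for r range over -2, …, 2. The shifts by 0, 2, -1, -2 kill all but weight 1, and
  -- those for s below kill all but weight -1; only the positions (r, s) and (s', r') have both.
  have h1 := weight_shift_mem hn hK (weight_shift_mem hn hK (weight_shift_mem hn hK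
    (weight_shift_mem hn hK hX r 0) r 2) r (-1)) r (-2)
  have h2 := weight_shift_mem hn hK (weight_shift_mem hn hK (weight_shift_mem hn hK
    (weight_shift_mem hn hK h1 s 0) s (-2)) s 1) s 2
  -- Each of the two fourfold products has value -6 at the surviving weight, whence 36.
  refine (K.smul_mem_iff (show (36 : k) ≠ 0 by norm_num)).1 ?_
  convert h2 using 1
  have hskew := gLie_le_skewLie σ ρ (hK.le X hX) r s
  ext p q
  have hu : uMat σ ρ r s (X r s) p q =
      if p = r ∧ q = s ∨ p = s.swap ∧ q = r.swap then X p q else 0 := by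
    rw [uMat_apply, Matrix.sub_apply]
    by_cases ha : p = r ∧ q = s
    · obtain ⟨rfl, rfl⟩ := ha
      rw [if_pos (Or.inl ⟨rfl, rfl⟩), Matrix.single_apply_same, Matrix.single_apply_of_ne, sub_zero]
      rintro ⟨h, -⟩
      exact ne_swap_of_hypBase_ne hrs h.symm
    by_cases hb : p = s.swap ∧ q = r.swap
    · obtain ⟨rfl, rfl⟩ := hb
      rw [if_pos (Or.inr ⟨rfl, rfl⟩), Matrix.single_apply_same, Matrix.single_apply_of_ne, zero_sub,
        hskew]
      rintro ⟨h, -⟩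
      exact ne_swap_of_hypBase_ne hrs h
    rw [if_neg (by tauto), Matrix.single_apply_of_ne, Matrix.single_apply_of_ne, sub_zero]
    · rintro ⟨rfl, rfl⟩
      exact hb ⟨rfl, rfl⟩
    · rintro ⟨rfl, rfl⟩
      exact ha ⟨rfl, rfl⟩
  rw [Matrix.smul_apply, hu]
  simp only [Matrix.of_apply, smul_smul]
  have n1 := ne_of_hypBase_ne hrs
  have n2 := ne_swap_of_hypBase_ne hrs
  have n3 := ne_swap_of_hypBase_ne hrs.symm
  have n4 := swap_ne_swap n1
  have n5 := ne_swap_self r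
  have n6 := ne_swap_self s
  have hcases : ∀ p : Fin n ⊕ Fin n, p = r ∨ p = s ∨ p = r.swap ∨ p = s.swap ∨
      (p ≠ r ∧ p ≠ s ∧ p ≠ r.swap ∧ p ≠ s.swap) := by
    intro p
    tauto
  rcases hcases p with rfl | rfl | rfl | rfl | ⟨a1, a2, a3, a4⟩ <;>
  rcases hcases q with rfl | rfl | rfl | rfl | ⟨b1, b2, b3, b4⟩ <;>
  simp [hypWeight, *, Ne.symm n1, Ne.symm n2, Ne.symm n3, Ne.symm n4, Ne.symm n5, Ne.symm n6] <;>
  norm_num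

end Field

/-! ### Functoriality and maximal kernels -/

section Ideals

variable {k R : Type*} [Field k] [Ring R] [Algebra k R] {σ : AlgInvolution k R} {ρ : ℤˣ} {n : ℕ}

/-- An ideal of `𝔤_{2n,ρ}(R)` as a subspace of the matrix algebra. -/
def LieIdeal.matrices (K : LieIdeal k (gLie σ n ρ)) :
    Submodule k (Matrix (Fin n ⊕ Fin n) (Fin n ⊕ Fin n) R) :=
  K.toSubmodule.map (gLie σ n ρ).toSubmodule.subtype

theorem LieIdeal.mem_matrices {K : LieIdeal k (gLie σ n ρ)}
    {X : Matrix (Fin n ⊕ Fin n) (Fin n ⊕ Fin n) R} :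
    X ∈ K.matrices ↔ ∃ h : X ∈ gLie σ n ρ, (⟨X, h⟩ : gLie σ n ρ) ∈ K := by
  constructor
  · rintro ⟨x, hx, rfl⟩
    exact ⟨x.2, hx⟩
  · rintro ⟨h, hx⟩
    exact ⟨_, hx, rfl⟩

theorem LieIdeal.isLieIdealIn_matrices (K : LieIdeal k (gLie σ n ρ)) :
    IsLieIdealIn (gLie σ n ρ) K.matrices where
  le X hX := (LieIdeal.mem_matrices.1 hX).1
  lie_mem X hX Y hY := by
    obtain ⟨hY, hYK⟩ := LieIdeal.mem_matrices.1 hY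
    exact LieIdeal.mem_matrices.2 ⟨(gLie σ n ρ).lie_mem hX hY, lie_mem_right k _ K ⟨X, hX⟩ _ hYK⟩

variable (σ ρ n) in
/-- The elements of `𝔤_{2n,ρ}(R)` with entries in a two-sided ideal `U` of `R`. -/
def entriesIdeal (U : Submodule k R) (hl : ∀ a, ∀ b ∈ U, a * b ∈ U) (hr : ∀ a ∈ U, ∀ b, a * b ∈ U) :
    LieIdeal k (gLie σ n ρ) where
  carrier := {X | ∀ r s, (X : Matrix (Fin n ⊕ Fin n) (Fin n ⊕ Fin n) R) r s ∈ U}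
  zero_mem' _ _ := zero_mem U
  add_mem' hX hY r s := add_mem (hX r s) (hY r s)
  smul_mem' c _ hX r s := U.smul_mem c (hX r s)
  lie_mem {X Y} hY r s := by
    change ⁅(X : Matrix (Fin n ⊕ Fin n) (Fin n ⊕ Fin n) R), (Y : Matrix _ _ R)⁆ r s ∈ U
    rw [Ring.lie_def, Matrix.sub_apply, Matrix.mul_apply, Matrix.mul_apply]
    exact sub_mem (sum_mem fun t _ => hl _ _ (hY t s)) (sum_mem fun t _ => hr _ (hY r t) _)

section Functoriality

variable {B : Type*} [Ring B] [Algebra k B] {τ : AlgInvolution k B} (φ : R →ₐ[k] B)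

theorem map_uMat (hφ : ∀ a, φ (σ.bar a) = τ.bar (φ a)) (r s : Fin n ⊕ Fin n) (a : R) :
    (uMat σ ρ r s a).map φ = uMat τ ρ r s (φ a) := by
  rw [uMat_apply, uMat_apply, Matrix.map_sub _ (map_sub φ), Matrix.map_single, Matrix.map_single,
    map_zsmul, hφ]

/-- The homomorphism `𝔤_{2n,ρ}(R) → 𝔤_{2n,ρ}(B)` induced by a homomorphism of algebras with
involution. -/
def gLieMap (hφ : ∀ a, φ (σ.bar a) = τ.bar (φ a)) (n : ℕ) (ρ : ℤˣ) : gLie σ n ρ →ₗ⁅k⁆ gLie τ n ρ where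
  toFun X := ⟨X.1.map φ, by
    refine gLie_le σ ρ (L := (gLie τ n ρ).comap φ.mapMatrix.toLieHom) (fun r s a hrs => ?_) X.2
    rw [LieSubalgebra.mem_comap, AlgHom.toLieHom_apply, AlgHom.mapMatrix_apply, map_uMat φ hφ]
    exact uMat_mem_gLie τ ρ hrs _⟩
  map_add' X Y := Subtype.ext (map_add φ.mapMatrix X.1 Y.1)
  map_smul' c X := Subtype.ext (map_smul φ.mapMatrix c X.1)
  map_lie' {X Y} := Subtype.ext (LieHom.map_lie (φ.mapMatrix (m := Fin n ⊕ Fin n)).toLieHom X.1 Y.1)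

theorem gLieMap_surjective (hφ : ∀ a, φ (σ.bar a) = τ.bar (φ a)) (hs : Function.Surjective φ) :
    Function.Surjective (gLieMap φ hφ n ρ) := by
  rintro ⟨Y, hY⟩
  have : Y ∈ (gLie σ n ρ).map (φ.mapMatrix (m := Fin n ⊕ Fin n)).toLieHom := by
    refine gLie_le τ ρ (fun r s b hrs => ?_) hY
    obtain ⟨a, rfl⟩ := hs b
    exact ⟨_, uMat_mem_gLie σ ρ hrs a, map_uMat φ hφ r s a⟩
  obtain ⟨X, hX, rfl⟩ := this
  exact ⟨⟨X, hX⟩, rfl⟩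

end Functoriality

variable [CharZero k]

/-- An ideal of `𝔤_{2n,ρ}(R)` with zero coefficient ideal consists of skew central scalars. -/
theorem eq_diagonal_of_coeffIdeal_eq_bot (hn : 3 ≤ n)
    {K : Submodule k (Matrix (Fin n ⊕ Fin n) (Fin n ⊕ Fin n) R)}
    (hK : IsLieIdealIn (gLie σ n ρ) K) (h : coeffIdeal σ ρ K = ⊥)
    {X : Matrix (Fin n ⊕ Fin n) (Fin n ⊕ Fin n) R} (hX : X ∈ K) :
    ∃ c : R, (∀ b, c * b = b * c) ∧ σ.bar c = -c ∧ X = Matrix.diagonal fun _ => c := by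
  have hoff : ∀ {X}, X ∈ K → ∀ {r s}, hypBase r ≠ hypBase s → X r s = 0 := by
    intro X hX r s hrs
    have := entry_mem_coeffIdeal hn hK hX hrs
    rwa [h, Submodule.mem_bot] at this
  have hlie : ∀ {r s t : Fin n ⊕ Fin n}, hypBase t ≠ hypBase r → hypBase s = hypBase r → ∀ b : R,
      X r s * b = ⁅X, uMat σ ρ s t b⁆ r t +
        (if r = s then b * X t t else 0) := by
    intro r s t htr hsr b
    have h1 : (X * uMat σ ρ s t b) r t = X r s * b := by
      rw [uMat_apply, mul_sub, Matrix.sub_apply, Matrix.mul_single_apply_same,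
        Matrix.mul_single_apply_of_ne, sub_zero]
      exact fun e => ne_swap_of_hypBase_ne (by rwa [hsr]) e
    have h2 : (uMat σ ρ s t b * X) r t = if r = s then b * X t t else 0 := by
      rw [uMat_apply, sub_mul, Matrix.sub_apply,
        Matrix.single_mul_apply_of_ne (h := ne_swap_of_hypBase_ne htr.symm), sub_zero]
      split_ifs with hrs
      · rw [hrs, Matrix.single_mul_apply_same]
      · exact Matrix.single_mul_apply_of_ne (h := hrs) ..
    rw [Ring.lie_def, Matrix.sub_apply, h1, h2, sub_add_cancel]
  -- The bracket [X, u_st(b)] lies in K, so its (r, t) entry vanishes too. This equation then forces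
  -- X r s = 0 for s = r', equal diagonal entries, and their centrality.
  have hz : ∀ {r s t : Fin n ⊕ Fin n}, hypBase t ≠ hypBase r → hypBase s = hypBase r → ∀ b : R,
      X r s * b = if r = s then b * X t t else 0 := by
    intro r s t htr hsr b
    have hst : hypBase s ≠ hypBase t := by rw [hsr]; exact htr.symm
    rw [hlie htr hsr b, hoff (hK.lie_mem_left hX (uMat_mem_gLie σ ρ (ne_of_hypBase_ne hst) b))
      htr.symm, zero_add]
  have hdd : ∀ r t, hypBase t ≠ hypBase r → X r r = X t t := by
    intro r t h
    have := hz h rfl 1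
    rwa [if_pos rfl, one_mul, mul_one] at this
  have hall : ∀ r t, X r r = X t t := by
    intro r t
    obtain ⟨p, hp, hp'⟩ := exists_hypBase_ne hn r t
    rw [hdd r p hp, hdd t p hp']
  let r₀ : Fin n ⊕ Fin n := .inl ⟨0, by omega⟩
  obtain ⟨t₀, ht₀, -⟩ := exists_hypBase_ne hn r₀ r₀
  refine ⟨X r₀ r₀, fun b => ?_, ?_, ?_⟩
  · have := hz ht₀ rfl b
    rwa [if_pos rfl, hall t₀ r₀] at this
  · have := gLie_le_skewLie σ ρ (hK.le X hX) r₀ r₀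
    rw [Int.units_mul_self, Units.val_one, one_smul, hall _ r₀] at this
    rw [← neg_eq_iff_eq_neg] at this
    exact this.symm
  · ext r s
    by_cases hrs : r = s
    · rw [hrs, Matrix.diagonal_apply_eq, hall]
    · rw [Matrix.diagonal_apply_ne _ hrs]
      by_cases hb : hypBase r = hypBase s
      · obtain ⟨t, ht, -⟩ := exists_hypBase_ne hn r r
        have := hz ht hb.symm 1
        rwa [if_neg hrs, mul_one] at this
      · exact hoff hX hb

/-- An algebra with involution without proper nonzero ideals stable under the involution, such that
`𝔤_{2n,ρ}` contains no nonzero skew central scalars. -/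
structure IsHypSimple (σ : AlgInvolution k R) (n : ℕ) (ρ : ℤˣ) : Prop where
  eq_bot_or_one_mem : ∀ U : Submodule k R, (∀ a ∈ U, ∀ b, b * a ∈ U) → (∀ a ∈ U, ∀ b, a * b ∈ U) →
    (∀ a ∈ U, σ.bar a ∈ U) → U = ⊥ ∨ 1 ∈ U
  eq_zero : ∀ c : R, (∀ b, c * b = b * c) → σ.bar c = -c →
    (Matrix.diagonal fun _ => c) ∈ gLie σ n ρ → c = 0

/-- The image of J is an ideal whose coefficient ideal is zero or everything. In the first case the
image consists of skew central scalars and is zero; in the second J maps onto the whole target. -/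
theorem sup_ker_gLieMap_eq_top {B : Type*} [Ring B] [Algebra k B] {τ : AlgInvolution k B}
    (φ : R →ₐ[k] B) (hφ : ∀ a, φ (σ.bar a) = τ.bar (φ a)) (hn : 3 ≤ n) (hB : IsHypSimple τ n ρ) (hs : Function.Surjective φ)
    (J : LieIdeal k (gLie σ n ρ)) (hJ : ¬ J ≤ (gLieMap φ hφ n ρ).ker) :
    J ⊔ (gLieMap φ hφ n ρ).ker = ⊤ := by
  set ψ := gLieMap φ hφ n ρ with hψ
  let J' : LieIdeal k (gLie τ n ρ) :=
    { J.toSubmodule.map (ψ : gLie σ n ρ →ₗ[k] gLie τ n ρ) with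
      lie_mem := by
        rintro X - ⟨Y, hY, rfl⟩
        obtain ⟨X, rfl⟩ := gLieMap_surjective φ hφ hs X
        exact ⟨⁅X, Y⁆, lie_mem_right k _ J X Y hY, LieHom.map_lie ψ X Y⟩ }
  have hJ' := LieIdeal.isLieIdealIn_matrices J'
  rcases hB.eq_bot_or_one_mem (coeffIdeal τ ρ J'.matrices)
    (fun a ha b => mul_mem_coeffIdeal_left hn hJ' ha b)
    (fun a ha b => mul_mem_coeffIdeal_right hn hJ' ha b)
    (fun a ha => bar_mem_coeffIdeal hn hJ' ha) with h | h
  · refine absurd (fun X hX => ?_) hJ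
    have hX' : (ψ X : Matrix _ _ B) ∈ J'.matrices :=
      LieIdeal.mem_matrices.2 ⟨(ψ X).2, X, hX, rfl⟩
    obtain ⟨c, hc, hc', he⟩ := eq_diagonal_of_coeffIdeal_eq_bot hn hJ' h hX'
    have hc0 : c = 0 := hB.eq_zero c hc hc' (he ▸ (ψ X).2)
    rw [LieHom.mem_ker]
    apply Subtype.ext
    rw [he, hc0]
    exact Matrix.diagonal_zero
  · rw [eq_top_iff]
    intro X _
    obtain ⟨_, Y, hY, hYX⟩ := LieIdeal.mem_matrices.1 (gLie_le_of_one_mem hn hJ' h (ψ X).2)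
    refine (LieSubmodule.mem_sup _ _ _).2 ⟨Y, hY, X - Y, ?_, add_sub_cancel _ _⟩
    rw [LieHom.mem_ker, map_sub, sub_eq_zero]
    exact hYX.symm

/-! ### Semiprimeness passes to the coefficient ideal -/

section Semiprime

variable {K : LieIdeal k (gLie σ n ρ)}
  (hK : ∀ D : LieIdeal k (gLie σ n ρ), (∀ x ∈ D, ∀ y ∈ D, ⁅x, y⁆ ∈ K) → D ≤ K)

include hK in
-- Such matrices form an ideal that is abelian modulo K by `lie_mem_of_entries_mem`, hence absorbed
-- by K.
theorem mem_of_entries_mem (hn : 3 ≤ n) {X : gLie σ n ρ}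
    (hX : ∀ r s, (X : Matrix (Fin n ⊕ Fin n) (Fin n ⊕ Fin n) R) r s ∈ coeffIdeal σ ρ K.matrices) :
    X ∈ K := by
  have hI := K.isLieIdealIn_matrices
  refine hK (entriesIdeal σ ρ n (coeffIdeal σ ρ K.matrices)
    (fun a b hb => mul_mem_coeffIdeal_left hn hI hb a)
    (fun a ha b => mul_mem_coeffIdeal_right hn hI ha b)) (fun x hx y hy => ?_) hX
  exact (LieIdeal.mem_matrices.1 (lie_mem_of_entries_mem hn hI x.2 y.2 hx hy)).2

include hK in
-- Brackets of matrices with entries in zR have entries in z²R, hence lie in K by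
-- `mem_of_entries_mem`. So all matrices of the Lie algebra with entries in zR lie in K, among them
-- u_rs(z), where bar z = z puts the second entry in zR as well.
theorem mem_coeffIdeal_of_mul_self_mem (hn : 3 ≤ n) {z : R} (hz : ∀ b, z * b = b * z)
    (hbar : σ.bar z = z) (h : z * z ∈ coeffIdeal σ ρ K.matrices) :
    z ∈ coeffIdeal σ ρ K.matrices := by
  have hI := K.isLieIdealIn_matrices
  let U : Submodule k R := LinearMap.range (LinearMap.mulLeft k z)
  have hl : ∀ a, ∀ b ∈ U, a * b ∈ U := by
    rintro a - ⟨b, rfl⟩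
    exact ⟨a * b, by simp only [LinearMap.mulLeft_apply, ← mul_assoc, hz a]⟩
  have hr : ∀ a ∈ U, ∀ b, a * b ∈ U := by
    rintro - ⟨a, rfl⟩ b
    exact ⟨a * b, by simp only [LinearMap.mulLeft_apply, mul_assoc]⟩
  have hprod : ∀ a ∈ U, ∀ b ∈ U, a * b ∈ coeffIdeal σ ρ K.matrices := by
    rintro - ⟨a, rfl⟩ - ⟨b, rfl⟩
    have := mul_mem_coeffIdeal_right hn hI h (a * b)
    rw [LinearMap.mulLeft_apply, LinearMap.mulLeft_apply]
    convert this using 1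
    rw [mul_assoc, ← mul_assoc a, ← hz a, mul_assoc z z, mul_assoc z a]
  have hDK := hK (entriesIdeal σ ρ n U hl hr) fun x hx y hy => by
    refine mem_of_entries_mem hK hn fun r s => ?_
    change ⁅x.1, y.1⁆ r s ∈ _
    rw [Ring.lie_def, Matrix.sub_apply, Matrix.mul_apply, Matrix.mul_apply]
    exact sub_mem (sum_mem fun t _ => hprod _ (hx r t) _ (hy t s))
      (sum_mem fun t _ => hprod _ (hy r t) _ (hx t s))
  obtain ⟨r, s, -, hrs, -, -⟩ := exists_three hn
  refine mem_coeffIdeal_of_uMat_mem hn hI hrs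
    (LieIdeal.mem_matrices.2 ⟨uMat_mem_gLie σ ρ (ne_of_hypBase_ne hrs) z, hDK fun p q => ?_⟩)
  have hzU : z ∈ U := ⟨1, mul_one z⟩
  have hsingle : ∀ (r s : Fin n ⊕ Fin n), ∀ a ∈ U, Matrix.single r s a p q ∈ U := by
    intro r s a ha
    rw [Matrix.single_apply]
    split_ifs
    exacts [ha, zero_mem U]
  change uMat σ ρ r s z p q ∈ U
  rw [uMat_apply, hbar]
  exact sub_mem (hsingle r s z hzU) (hsingle _ _ _ (zsmul_mem hzU _))

include hK in
theorem mem_coeffIdeal_of_pow_mem (hn : 3 ≤ n) {z : R} (hz : ∀ b, z * b = b * z)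
    (hbar : σ.bar z = z) {N : ℕ} (h : z ^ N ∈ coeffIdeal σ ρ K.matrices) :
    z ∈ coeffIdeal σ ρ K.matrices := by
  have hI := K.isLieIdealIn_matrices
  have hpow : ∀ j : ℕ, (∀ b, z ^ j * b = b * z ^ j) ∧ σ.bar (z ^ j) = z ^ j := by
    intro j
    induction j with
    | zero => exact ⟨fun b => by rw [pow_zero, one_mul, mul_one], by rw [pow_zero, σ.bar_one]⟩
    | succ j ih =>
      refine ⟨fun b => ?_, ?_⟩
      · rw [pow_succ, mul_assoc, hz, ← mul_assoc, ih.1, mul_assoc]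
      · rw [pow_succ, σ.bar_mul, ih.2, hbar, hz]
  -- Raising the exponent to a power of two allows descent by repeated square roots.
  have h2 : z ^ (2 ^ N) ∈ coeffIdeal σ ρ K.matrices := by
    have := mul_mem_coeffIdeal_right hn hI h (z ^ (2 ^ N - N))
    rwa [← pow_add, Nat.add_sub_of_le Nat.lt_two_pow_self.le] at this
  clear h
  induction N with
  | zero => simpa using h2
  | succ N ih =>
    refine ih (mem_coeffIdeal_of_mul_self_mem hK hn (hpow _).1 (hpow _).2 ?_)
    rwa [← pow_add, ← two_mul, ← pow_succ']

end Semiprime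

/-! ### Finite-dimensional modules -/

section Module

variable (V : Type*) [AddCommGroup V] [Module k V] [LieRingModule (gLie σ n ρ) V]
  [LieModule k (gLie σ n ρ) V]

omit [CharZero k] in
-- Traces of commutators vanish, so the trace-zero elements form an ideal. It contains u_rt(1) =
-- [u_rs(1), u_st(1)] and is therefore everything.
theorem trace_toEnd_gLie_eq_zero (hn : 3 ≤ n) (x : gLie σ n ρ) :
    LinearMap.trace k V (LieModule.toEnd k (gLie σ n ρ) V x) = 0 := by
  let J : LieIdeal k (gLie σ n ρ) :=
    { LinearMap.ker (LinearMap.trace k V ∘ₗ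
        (LieModule.toEnd k (gLie σ n ρ) V : gLie σ n ρ →ₗ[k] Module.End k V)) with
      lie_mem := fun {x y} _ => by
        change LinearMap.trace k V (LieModule.toEnd k (gLie σ n ρ) V ⁅x, y⁆) = 0
        rw [LieHom.map_lie, LinearMap.trace_lie] }
  have hJ := J.isLieIdealIn_matrices
  obtain ⟨r, s, t, hrs, hrt, hst⟩ := exists_three hn
  have h1 : (1 : R) ∈ coeffIdeal σ ρ J.matrices := by
    refine mem_coeffIdeal_of_uMat_mem hn hJ hrt ?_
    let x : gLie σ n ρ := ⟨_, uMat_mem_gLie σ ρ (ne_of_hypBase_ne hrs) 1⟩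
    let y : gLie σ n ρ := ⟨_, uMat_mem_gLie σ ρ (ne_of_hypBase_ne hst) 1⟩
    have hxy : ⁅x, y⁆.1 = uMat σ ρ r t 1 := by
      have := uMat_lie_uMat σ ρ (ne_of_hypBase_ne hrt) (ne_swap_of_hypBase_ne hst)
        (ne_swap_of_hypBase_ne hrs) 1 1
      rwa [mul_one] at this
    rw [← hxy]
    refine LieIdeal.mem_matrices.2 ⟨⁅x, y⁆.2, ?_⟩
    change LinearMap.trace k V (LieModule.toEnd k (gLie σ n ρ) V ⁅x, y⁆) = 0
    rw [LieHom.map_lie, LinearMap.trace_lie]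
  obtain ⟨_, h⟩ := LieIdeal.mem_matrices.1 (gLie_le_of_one_mem hn hJ h1 x.2)
  exact h

omit [CharZero k] in
/-- The coefficient ideal of the annihilator of `V` contains the kernel of a linear map into
`End V`. -/
theorem exists_ker_le_coeffIdeal (hn : 3 ≤ n) : ∃ f : R →ₗ[k] Module.End k V,
    ∀ a, f a = 0 → a ∈ coeffIdeal σ ρ (LieModule.ker k (gLie σ n ρ) V).matrices := by
  obtain ⟨r, s, -, hrs, -, -⟩ := exists_three hn
  refine ⟨(LieModule.toEnd k (gLie σ n ρ) V : gLie σ n ρ →ₗ[k] Module.End k V) ∘ₗ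
    (uMat σ ρ r s).codRestrict (gLie σ n ρ).toSubmodule
      fun a => uMat_mem_gLie σ ρ (ne_of_hypBase_ne hrs) a, fun a ha => ?_⟩
  exact mem_coeffIdeal_of_uMat_mem hn (LieIdeal.isLieIdealIn_matrices _) hrs
    (LieIdeal.mem_matrices.2 ⟨uMat_mem_gLie σ ρ (ne_of_hypBase_ne hrs) a, ha⟩)

end Module

end Ideals

/-! ### Central elements, interpolation and annihilating polynomials -/

section CentralFixed

variable {k R : Type*} [CommRing k] [Ring R] [Algebra k R]

/-- The subalgebra of central elements fixed by the involution. -/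
def centralFixed (σ : AlgInvolution k R) : Subalgebra k R where
  carrier := {z | (∀ b, z * b = b * z) ∧ σ.bar z = z}
  mul_mem' {x y} hx hy := ⟨fun b => by rw [mul_assoc, hy.1, ← mul_assoc, hx.1, mul_assoc],
    by rw [σ.bar_mul, hx.2, hy.2, hx.1]⟩
  add_mem' {x y} hx hy := ⟨fun b => by rw [add_mul, mul_add, hx.1, hy.1],
    by rw [map_add, hx.2, hy.2]⟩
  algebraMap_mem' c := ⟨Algebra.commutes c,
    by rw [Algebra.algebraMap_eq_smul_one, map_smul, σ.bar_one]⟩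

/-- Lagrange interpolation: if `∏ (z - α)` annihilates modulo a left ideal `I`, then an element
lying in each `I + (z - α) R` lies in `I`. -/
theorem mem_of_forall_sub_mul_mem {k R : Type*} [Field k] [Ring R] [Algebra k R]
    {I : Submodule k R} (hI : ∀ a, ∀ b ∈ I, a * b ∈ I) {z : R} {S : Finset k}
    (hS : ∀ y, Polynomial.aeval z (∏ α ∈ S, (Polynomial.X - Polynomial.C α)) * y ∈ I) {x : R}
    (hx : ∀ α ∈ S, ∃ y, x - (z - algebraMap k R α) * y ∈ I) : x ∈ I := by
  classical
  rcases S.eq_empty_or_nonempty with rfl | hne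
  · simpa using hS x
  have h1 : Polynomial.aeval z (∑ α ∈ S, Lagrange.basis S id α) * x = x := by
    rw [Lagrange.sum_basis Function.injective_id.injOn hne, map_one, one_mul]
  rw [← h1, map_sum, Finset.sum_mul]
  refine sum_mem fun α hα => ?_
  obtain ⟨y, hy⟩ := hx α hα
  -- The basis polynomial of α already contains the factors of the other nodes, so times X - α it is
  -- a multiple of the full product.
  obtain ⟨p, hp⟩ : (∏ α ∈ S, (Polynomial.X - Polynomial.C α)) ∣
      (Polynomial.X - Polynomial.C α) * Lagrange.basis S id α := by
    rw [← Finset.mul_prod_erase S _ hα, Lagrange.basis]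
    exact mul_dvd_mul_left _ (Finset.prod_dvd_prod_of_dvd _ _ fun β _ => dvd_mul_left _ _)
  have h2 : Polynomial.aeval z (Lagrange.basis S id α) * ((z - algebraMap k R α) * y) ∈ I := by
    have : Polynomial.aeval z (Lagrange.basis S id α) * (z - algebraMap k R α) =
        Polynomial.aeval z (∏ α ∈ S, (Polynomial.X - Polynomial.C α)) * Polynomial.aeval z p := by
      rw [← map_mul, ← hp, mul_comm, map_mul, map_sub, Polynomial.aeval_X, Polynomial.aeval_C]
    rw [← mul_assoc, this, mul_assoc]
    exact hS _
  have h3 := add_mem (hI (Polynomial.aeval z (Lagrange.basis S id α)) _ hy) h2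
  rwa [← mul_add, sub_add_cancel] at h3

end CentralFixed

section AnnihilatingPolynomial

variable {k R : Type*} [Field k] [CharZero k] [IsAlgClosed k] [Ring R] [Algebra k R]
  {σ : AlgInvolution k R} {ρ : ℤˣ} {n : ℕ}

/-- Modulo the coefficient ideal of a cofinite semiprime ideal, an invertible central element fixed
by the involution is annihilated by a polynomial with simple nonzero roots. -/
theorem exists_finset_aeval_prod_mem {E : Type*} [AddCommGroup E] [Module k E]
    [FiniteDimensional k E] {K : LieIdeal k (gLie σ n ρ)}
    (hK : ∀ D : LieIdeal k (gLie σ n ρ), (∀ x ∈ D, ∀ y ∈ D, ⁅x, y⁆ ∈ K) → D ≤ K) (hn : 3 ≤ n)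
    (f : R →ₗ[k] E) (hf : ∀ a, f a = 0 → a ∈ coeffIdeal σ ρ K.matrices) {z w : R}
    (hz : z ∈ centralFixed σ) (hwz : w * z = 1) :
    ∃ S : Finset k, 0 ∉ S ∧ Polynomial.aeval z (∏ α ∈ S, (Polynomial.X - Polynomial.C α)) ∈
      coeffIdeal σ ρ K.matrices := by
  classical
  have hI := K.isLieIdealIn_matrices
  let F : Polynomial k →ₗ[k] E := f ∘ₗ (Polynomial.aeval z).toLinearMap
  -- k[X] is infinite-dimensional and E is not, so some nonzero p has f(p(z)) = 0.
  obtain ⟨p, hp, hp0⟩ : ∃ p, F p = 0 ∧ p ≠ 0 := by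
    by_contra! h
    have hinj : Function.Injective F := by
      rw [injective_iff_map_eq_zero]
      exact h
    exact Polynomial.not_finite (R := k) (Module.Finite.of_injective F hinj)
  have hpI : Polynomial.aeval z p ∈ coeffIdeal σ ρ K.matrices := hf _ hp
  set S := p.roots.toFinset.erase 0 with hS
  set m := ∏ α ∈ S, (Polynomial.X - Polynomial.C α) with hm
  -- Every linear factor of p divides X m, the factor X taking care of the root 0. Semiprimeness
  -- then removes the power, and the inverse w of z removes X.
  have hdvd : p ∣ (Polynomial.X * m) ^ p.roots.card := by
    have h1 : (p.roots.map fun a => Polynomial.X - Polynomial.C a).prod ∣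
        (p.roots.map fun _ => Polynomial.X * m).prod := by
      refine Multiset.prod_dvd_prod_of_dvd _ _ fun a ha => ?_
      by_cases h0 : a = 0
      · rw [h0, map_zero, sub_zero]
        exact dvd_mul_right _ _
      · exact (Finset.dvd_prod_of_mem _
          (Finset.mem_erase.2 ⟨h0, Multiset.mem_toFinset.2 ha⟩)).mul_left _
    rw [Multiset.map_const', Multiset.prod_replicate] at h1
    obtain ⟨N, hN⟩ : ∃ N, N = p.roots.card := ⟨_, rfl⟩
    rw [← hN] at h1 ⊢
    rw [(IsAlgClosed.splits p).eq_prod_roots]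
    exact ((Polynomial.isUnit_C.2 (isUnit_iff_ne_zero.2
      (Polynomial.leadingCoeff_ne_zero.2 hp0))).mul_left_dvd).2 h1
  refine ⟨S, Finset.notMem_erase _ _, ?_⟩
  obtain ⟨r, hr⟩ := hdvd
  have hmem : ∀ g : Polynomial k, Polynomial.aeval z g ∈ centralFixed σ := fun g =>
    Algebra.adjoin_le (Set.singleton_subset_iff.2 hz) (Polynomial.aeval_mem_adjoin_singleton k z)
  have h2 : Polynomial.aeval z (Polynomial.X * m) ^ p.roots.card ∈
      coeffIdeal σ ρ K.matrices := by
    rw [← map_pow, hr, map_mul]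
    exact mul_mem_coeffIdeal_right hn hI hpI _
  have h3 := mem_coeffIdeal_of_pow_mem hK hn (hmem _).1 (hmem _).2 h2
  have h4 := mul_mem_coeffIdeal_left hn hI h3 w
  rwa [map_mul, Polynomial.aeval_X, ← mul_assoc, hwz, one_mul] at h4

end AnnihilatingPolynomial

/-! ### The quantum torus over its central squares -/

namespace QTorus

/-- The universal property gives a map into S sending generators to themselves; followed by the
inclusion it is the identity. -/
theorem subalgebra_eq_top {q : ℤˣ} {S : Subalgebra ℂ (QTorus q)} (h : ∀ x, gen q x ∈ S) :
    S = ⊤ := by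
  let φ : QTorus q →ₐ[ℂ] S := RingQuot.liftAlgHom ℂ
    ⟨FreeAlgebra.lift ℂ fun x => ⟨gen q x, h x⟩, by
      intro a b hab
      have hval : ∀ y, ((FreeAlgebra.lift ℂ fun x => (⟨gen q x, h x⟩ : S)) y : QTorus q) =
          RingQuot.mkAlgHom ℂ (QTorusRel q) y := by
        intro y
        have : (S.val.comp (FreeAlgebra.lift ℂ fun x => (⟨gen q x, h x⟩ : S))) =
            RingQuot.mkAlgHom ℂ (QTorusRel q) := by
          refine FreeAlgebra.hom_ext ?_
          funext x
          exact congrArg Subtype.val (FreeAlgebra.lift_ι_apply _ x)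
        exact congrArg (fun φ => φ y) this
      apply Subtype.ext
      rw [hval, hval]
      exact RingQuot.mkAlgHom_rel ℂ hab⟩
  have hφ : S.val.comp φ = AlgHom.id ℂ (QTorus q) := by
    refine algHom_ext fun x => ?_
    have : φ (gen q x) = ⟨gen q x, h x⟩ :=
      (RingQuot.liftAlgHom_mkAlgHom_apply ℂ (s := QTorusRel q) _ _ _).trans
        (FreeAlgebra.lift_ι_apply _ x)
    rw [AlgHom.comp_apply, this]
    rfl
  rw [eq_top_iff]
  intro x _
  have := congrArg (fun ψ : QTorus q →ₐ[ℂ] QTorus q => ψ x) hφ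
  have h2 : (φ x : QTorus q) = x := this
  rw [← h2]
  exact (φ x).2

theorem forall_commute {q : ℤˣ} {z : QTorus q} (h₁ : z * gen q .t₁ = gen q .t₁ * z)
    (h₂ : z * gen q .t₂ = gen q .t₂ * z) (b : QTorus q) : z * b = b * z := by
  have hinv : ∀ {a a' : QTorus q}, a * a' = 1 → a' * a = 1 → z * a = a * z → z * a' = a' * z := by
    intro a a' h h' hz
    calc z * a' = (a' * a) * z * a' := by rw [h', one_mul]
      _ = a' * (z * a) * a' := by rw [hz, mul_assoc a' a z]
      _ = a' * z := by rw [mul_assoc, mul_assoc z, h, mul_one]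
  have htop : Subalgebra.centralizer ℂ {z} = ⊤ := by
    refine subalgebra_eq_top fun x => ?_
    rw [Subalgebra.mem_centralizer_iff]
    intro z' hz'
    rw [Set.mem_singleton_iff.1 hz']
    cases x
    · exact h₁
    · exact hinv (t₁_mul_inv q) (t₁_inv_mul q) h₁
    · exact h₂
    · exact hinv (t₂_mul_inv q) (t₂_inv_mul q) h₂
  have hb : b ∈ Subalgebra.centralizer ℂ {z} := by rw [htop]; trivial
  exact (Subalgebra.mem_centralizer_iff ℂ).1 hb z rfl

theorem t₁_mul_t₂ (q : ℤˣ) : gen q .t₁ * gen q .t₂ = (q : ℤ) • (gen q .t₂ * gen q .t₁) := by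
  rw [t₂_mul_t₁, smul_smul, ← Units.val_mul, Int.units_mul_self, Units.val_one, one_smul]

theorem t₁_sq_mul (q : ℤˣ) (b : QTorus q) :
    gen q .t₁ * gen q .t₁ * b = b * (gen q .t₁ * gen q .t₁) := by
  refine forall_commute (mul_assoc _ _ _) ?_ b
  rw [mul_assoc, t₁_mul_t₂, mul_smul_comm, ← mul_assoc, t₁_mul_t₂, smul_mul_assoc, smul_smul,
    ← Units.val_mul, Int.units_mul_self, Units.val_one, one_smul, mul_assoc]

theorem t₂_sq_mul (q : ℤˣ) (b : QTorus q) :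
    gen q .t₂ * gen q .t₂ * b = b * (gen q .t₂ * gen q .t₂) := by
  refine forall_commute ?_ (mul_assoc _ _ _) b
  rw [mul_assoc, t₂_mul_t₁, mul_smul_comm, ← mul_assoc, t₂_mul_t₁, smul_mul_assoc, smul_smul,
    ← Units.val_mul, Int.units_mul_self, Units.val_one, one_smul, mul_assoc]

theorem t₁_sq_mem_centralFixed (q θ₁ θ₂ : ℤˣ) :
    gen q .t₁ * gen q .t₁ ∈ centralFixed (involution q θ₁ θ₂) := by
  refine ⟨t₁_sq_mul q, ?_⟩
  rw [(involution q θ₁ θ₂).bar_mul, involution_t₁, smul_mul_smul_comm, ← Units.val_mul,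
    Int.units_mul_self, Units.val_one, one_smul]

theorem t₂_sq_mem_centralFixed (q θ₁ θ₂ : ℤˣ) :
    gen q .t₂ * gen q .t₂ ∈ centralFixed (involution q θ₁ θ₂) := by
  refine ⟨t₂_sq_mul q, ?_⟩
  rw [(involution q θ₁ θ₂).bar_mul, involution_t₂, smul_mul_smul_comm, ← Units.val_mul,
    Int.units_mul_self, Units.val_one, one_smul]

/-- Modulo `t₁² - α` and `t₂² - β`, the quantum torus is spanned by `1, t₁, t₂, t₁ t₂`. -/
theorem exists_eq_add_mul (q : ℤˣ) {α β : ℂ} (hα : α ≠ 0) (hβ : β ≠ 0) (x : QTorus q) :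
    ∃ (c₀ c₁ c₂ c₃ : ℂ) (y z : QTorus q), x = c₀ • 1 + c₁ • gen q .t₁ + c₂ • gen q .t₂ +
      c₃ • (gen q .t₁ * gen q .t₂) + ((gen q .t₁ * gen q .t₁ - algebraMap ℂ _ α) * y +
      (gen q .t₂ * gen q .t₂ - algebraMap ℂ _ β) * z) := by
  set t₁ := gen q .t₁ with ht₁
  set t₂ := gen q .t₂ with ht₂
  set X := t₁ * t₁ - algebraMap ℂ (QTorus q) α with hX
  set Y := t₂ * t₂ - algebraMap ℂ (QTorus q) β with hY
  have hXc : ∀ a, a * X = X * a := fun a => by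
    rw [hX, mul_sub, sub_mul, t₁_sq_mul, Algebra.commutes]
  have hYc : ∀ a, a * Y = Y * a := fun a => by
    rw [hY, mul_sub, sub_mul, t₂_sq_mul, Algebra.commutes]
  have h11 : t₁ * t₁ = α • 1 + X * 1 := by
    rw [hX, mul_one, Algebra.algebraMap_eq_smul_one]; abel
  have h22 : t₂ * t₂ = β • 1 + Y * 1 := by
    rw [hY, mul_one, Algebra.algebraMap_eq_smul_one]; abel
  let N : Submodule ℂ (QTorus q) :=
    LinearMap.range (LinearMap.mulLeft ℂ X) ⊔ LinearMap.range (LinearMap.mulLeft ℂ Y)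
  have hXN : ∀ a, X * a ∈ N := fun a => Submodule.mem_sup_left ⟨a, rfl⟩
  have hYN : ∀ a, Y * a ∈ N := fun a => Submodule.mem_sup_right ⟨a, rfl⟩
  have hNl : ∀ a, ∀ b ∈ N, a * b ∈ N := by
    intro a b hb
    obtain ⟨-, ⟨y, rfl⟩, -, ⟨z, rfl⟩, rfl⟩ := Submodule.mem_sup.1 hb
    rw [mul_add, LinearMap.mulLeft_apply, LinearMap.mulLeft_apply, ← mul_assoc, ← mul_assoc, hXc,
      hYc, mul_assoc, mul_assoc]
    exact add_mem (hXN _) (hYN _)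
  -- W is shown to be stable under left multiplication by all four generators, hence by every x;
  -- applying x to 1 gives the claim.
  let W : Submodule ℂ (QTorus q) := Submodule.span ℂ {1, t₁, t₂, t₁ * t₂} ⊔ N
  have hNW : ∀ {a}, a ∈ N → a ∈ W := fun h => Submodule.mem_sup_right h
  have hgW : ∀ {a}, a ∈ ({1, t₁, t₂, t₁ * t₂} : Set (QTorus q)) → a ∈ W := fun h =>
    Submodule.mem_sup_left (Submodule.subset_span h)
  have hclosed : ∀ a, a ∈ W → a * t₁ ∈ W → a * t₂ ∈ W → a * (t₁ * t₂) ∈ W → ∀ w ∈ W, a * w ∈ W := by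
    intro a h0 h1 h2 h3 w hw
    obtain ⟨u, hu, v, hv, rfl⟩ := Submodule.mem_sup.1 hw
    rw [mul_add]
    refine add_mem ?_ (hNW (hNl a v hv))
    clear hw
    induction hu using Submodule.span_induction with
    | mem x hx =>
      rcases hx with rfl | rfl | rfl | rfl
      exacts [by rwa [mul_one], h1, h2, h3]
    | zero => rw [mul_zero]; exact zero_mem W
    | add x y _ _ hx hy => rw [mul_add]; exact add_mem hx hy
    | smul c x _ hx => rw [mul_smul_comm]; exact W.smul_mem c hx
  have hW1 : (1 : QTorus q) ∈ W := hgW (by simp)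
  have hWt₁ : t₁ ∈ W := hgW (by simp)
  have hWt₂ : t₂ ∈ W := hgW (by simp)
  have hWt₃ : t₁ * t₂ ∈ W := hgW (by simp)
  have hW₁ : ∀ w ∈ W, t₁ * w ∈ W := by
    refine hclosed t₁ hWt₁ ?_ hWt₃ ?_
    · rw [h11]
      exact add_mem (W.smul_mem _ hW1) (hNW (hXN _))
    · rw [← mul_assoc, h11, add_mul, smul_one_mul, mul_one]
      exact add_mem (W.smul_mem _ hWt₂) (hNW (hXN _))
  have hW₂ : ∀ w ∈ W, t₂ * w ∈ W := by
    refine hclosed t₂ hWt₂ ?_ ?_ ?_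
    · rw [t₂_mul_t₁]
      exact zsmul_mem hWt₃ _
    · rw [h22]
      exact add_mem (W.smul_mem _ hW1) (hNW (hYN _))
    · rw [← mul_assoc, t₂_mul_t₁, smul_mul_assoc, mul_assoc, ← t₂_sq_mul, ← ht₁, ← ht₂, h22,
        add_mul, smul_one_mul, mul_one]
      exact zsmul_mem (add_mem (W.smul_mem _ hWt₁) (hNW (hYN _))) _
  -- Modulo Z = t² - γ the inverse of t is γ⁻¹ t, so stability under t gives stability under t'.
  have hinv : ∀ {t t' Z : QTorus q} {γ : ℂ}, γ ≠ 0 → t * t' = 1 → Z = t * t - algebraMap ℂ _ γ →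
      (∀ a, Z * a ∈ N) → (∀ w ∈ W, t * w ∈ W) → ∀ w ∈ W, t' * w ∈ W := by
    intro t t' Z γ hγ htt hZ hZN hW w hw
    have h : t' * w = γ⁻¹ • (t * w - Z * (t' * w)) := by
      rw [hZ, sub_mul, mul_assoc t t, ← mul_assoc t t', htt, one_mul, sub_sub_cancel,
        ← Algebra.smul_def, smul_smul, inv_mul_cancel₀ hγ, one_smul]
    rw [h]
    exact W.smul_mem _ (sub_mem (hW w hw) (hNW (hZN _)))
  let A : Subalgebra ℂ (QTorus q) :=
    { carrier := {a | ∀ w ∈ W, a * w ∈ W}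
      mul_mem' := fun ha hb w hw => by rw [mul_assoc]; exact ha _ (hb w hw)
      add_mem' := fun ha hb w hw => by rw [add_mul]; exact add_mem (ha w hw) (hb w hw)
      algebraMap_mem' := fun c w hw => by rw [← Algebra.smul_def]; exact W.smul_mem c hw }
  have hA : A = ⊤ := by
    refine subalgebra_eq_top fun g => ?_
    cases g
    · exact hW₁
    · exact hinv hα (t₁_mul_inv q) rfl hXN hW₁
    · exact hW₂
    · exact hinv hβ (t₂_mul_inv q) rfl hYN hW₂
  have hxA : x ∈ A := by rw [hA]; trivial
  have hxW := hxA 1 hW1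
  rw [mul_one] at hxW
  obtain ⟨u, hu, v, hv, rfl⟩ := Submodule.mem_sup.1 hxW
  obtain ⟨-, ⟨y, rfl⟩, -, ⟨z, rfl⟩, rfl⟩ := Submodule.mem_sup.1 hv
  simp only [Submodule.mem_span_insert, Submodule.mem_span_singleton] at hu
  obtain ⟨c₀, -, ⟨c₁, -, ⟨c₂, -, ⟨c₃, rfl⟩, rfl⟩, rfl⟩, rfl⟩ := hu
  refine ⟨c₀, c₁, c₂, c₃, y, z, ?_⟩
  rw [LinearMap.mulLeft_apply, LinearMap.mulLeft_apply]
  abel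

end QTorus

/-- An involution `τ` as a homomorphism to the opposite algebra. -/
def AlgInvolution.toOp {k B : Type*} [CommRing k] [Ring B] [Algebra k B] (τ : AlgInvolution k B) :
    B →ₐ[k] Bᵐᵒᵖ where
  toFun b := MulOpposite.op (τ.bar b)
  map_one' := by rw [τ.bar_one]; rfl
  map_mul' a b := by rw [τ.bar_mul]; rfl
  map_zero' := by rw [map_zero]; rfl
  map_add' a b := by rw [map_add]; rfl
  commutes' c := by
    rw [Algebra.algebraMap_eq_smul_one, map_smul, τ.bar_one, Algebra.algebraMap_eq_smul_one]
    rfl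

/-- Elements `T₁`, `T₂` with square `1` satisfying the relations of the quantum torus, which span
the algebra with involution `B` together with `1` and `T₁ T₂`. -/
structure IsTorusModel (q θ₁ θ₂ : ℤˣ) {B : Type*} [Ring B] [Algebra ℂ B] (τ : AlgInvolution ℂ B)
    (T₁ T₂ : B) : Prop where
  sq₁ : T₁ * T₁ = 1
  sq₂ : T₂ * T₂ = 1
  comm : T₂ * T₁ = (q : ℤ) • (T₁ * T₂)
  bar₁ : τ.bar T₁ = (θ₁ : ℤ) • T₁
  bar₂ : τ.bar T₂ = (θ₂ : ℤ) • T₂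
  span : ∀ b : B, ∃ c₀ c₁ c₂ c₃ : ℂ, b = c₀ • 1 + c₁ • T₁ + c₂ • T₂ + c₃ • (T₁ * T₂)

/-! ### Evaluations of the quantum torus in a model -/

namespace IsTorusModel

variable {q θ₁ θ₂ : ℤˣ} {B : Type*} [Ring B] [Algebra ℂ B] {τ : AlgInvolution ℂ B} {T₁ T₂ : B}

/-- The images of the generators under evaluation at `(s, u)`. -/
noncomputable def genImage (T₁ T₂ : B) (s u : ℂˣ) : QTorusGen → B
  | .t₁ => (s : ℂ) • T₁
  | .t₁inv => (s : ℂ)⁻¹ • T₁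
  | .t₂ => (u : ℂ) • T₂
  | .t₂inv => (u : ℂ)⁻¹ • T₂

/-- The homomorphism `ℂ_q → B` with `t₁ ↦ s T₁` and `t₂ ↦ u T₂`. -/
noncomputable def eval (h : IsTorusModel q θ₁ θ₂ τ T₁ T₂) (s u : ℂˣ) : QTorus q →ₐ[ℂ] B :=
  RingQuot.liftAlgHom ℂ ⟨FreeAlgebra.lift ℂ (genImage T₁ T₂ s u), by
    intro a b hab
    cases hab
    · simp [genImage, smul_smul, h.sq₁]
    · simp [genImage, smul_smul, h.sq₁]
    · simp [genImage, smul_smul, h.sq₂]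
    · simp [genImage, smul_smul, h.sq₂]
    · simp [genImage, smul_smul, h.comm, mul_comm (u : ℂ)]⟩

variable (h : IsTorusModel q θ₁ θ₂ τ T₁ T₂) (s u : ℂˣ)

theorem eval_gen (x : QTorusGen) : h.eval s u (QTorus.gen q x) = genImage T₁ T₂ s u x :=
  (RingQuot.liftAlgHom_mkAlgHom_apply ℂ (s := QTorusRel q) _ _ _).trans
    (FreeAlgebra.lift_ι_apply _ x)

theorem eval_bar (a : QTorus q) :
    h.eval s u ((QTorus.involution q θ₁ θ₂).bar a) = τ.bar (h.eval s u a) := by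
  have key : (AlgHom.op (h.eval s u)).comp (QTorus.barHom q θ₁ θ₂) =
      τ.toOp.comp (h.eval s u) := by
    refine QTorus.algHom_ext fun x => ?_
    rw [AlgHom.comp_apply, AlgHom.comp_apply, QTorus.barHom_gen, eval_gen]
    change MulOpposite.op (h.eval s u (_ • QTorus.gen q x)) = MulOpposite.op (τ.bar _)
    rw [map_zsmul, eval_gen]
    congr 1
    cases x <;> simp only [genImage, QTorus.genSign, map_smul, h.bar₁, h.bar₂] <;>
      exact smul_comm _ _ _
  exact congrArg (fun φ : QTorus q →ₐ[ℂ] Bᵐᵒᵖ => (φ a).unop) key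

theorem eval_surjective : Function.Surjective (h.eval s u) := by
  intro b
  obtain ⟨c₀, c₁, c₂, c₃, rfl⟩ := h.span b
  refine ⟨c₀ • 1 + (c₁ * (s : ℂ)⁻¹) • QTorus.gen q .t₁ + (c₂ * (u : ℂ)⁻¹) • QTorus.gen q .t₂ +
    (c₃ * (s : ℂ)⁻¹ * (u : ℂ)⁻¹) • (QTorus.gen q .t₁ * QTorus.gen q .t₂), ?_⟩
  have hs : (s : ℂ) ≠ 0 := s.ne_zero
  have hu : (u : ℂ) ≠ 0 := u.ne_zero
  simp only [map_add, map_smul, map_mul, eval_gen, genImage, map_one, smul_mul_smul_comm,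
    smul_smul]
  congr 2
  · congr 2
    field_simp
  · field_simp
  · field_simp

/-- Fourier inversion on the group of sign changes: the four signed sums isolate one term each, up
to the factor 4, and 1, T₁, T₂, T₁T₂ are nonzero. They may be linearly dependent in B, so a single
evaluation would not suffice. -/
theorem eq_zero_of_forall_signs [Nontrivial B] (h : IsTorusModel q θ₁ θ₂ τ T₁ T₂) (s u : ℂˣ)
    {c₀ c₁ c₂ c₃ : ℂ}
    (h0 : ∀ s' u' : ℂˣ, (s' = s ∨ s' = -s) → (u' = u ∨ u' = -u) →
      c₀ • (1 : B) + (c₁ * s') • T₁ + (c₂ * u') • T₂ + (c₃ * (s' * u')) • (T₁ * T₂) = 0) :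
    c₀ = 0 ∧ c₁ = 0 ∧ c₂ = 0 ∧ c₃ = 0 := by
  have e1 := h0 s u (Or.inl rfl) (Or.inl rfl)
  have e2 := h0 (-s) u (Or.inr rfl) (Or.inl rfl)
  have e3 := h0 s (-u) (Or.inl rfl) (Or.inr rfl)
  have e4 := h0 (-s) (-u) (Or.inr rfl) (Or.inr rfl)
  simp only [Units.val_neg, mul_neg, neg_mul, neg_neg, neg_smul] at e1 e2 e3 e4
  have hT₁ : T₁ ≠ 0 := fun e => one_ne_zero (α := B) (by rw [← h.sq₁, e, mul_zero])
  have hT₂ : T₂ ≠ 0 := fun e => one_ne_zero (α := B) (by rw [← h.sq₂, e, mul_zero])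
  have hT₃ : T₁ * T₂ ≠ 0 := fun e => hT₂ (by rw [← one_mul T₂, ← h.sq₁, mul_assoc, e, mul_zero])
  have h4 : (4 : ℂ) ≠ 0 := by norm_num
  have k0 : (4 * c₀) • (1 : B) = 0 := by linear_combination (norm := module) e1 + e2 + e3 + e4
  have k1 : (4 * (c₁ * s)) • T₁ = 0 := by linear_combination (norm := module) e1 - e2 + e3 - e4
  have k2 : (4 * (c₂ * u)) • T₂ = 0 := by linear_combination (norm := module) e1 + e2 - e3 - e4
  have k3 : (4 * (c₃ * (s * u))) • (T₁ * T₂) = 0 := by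
    linear_combination (norm := module) e1 - e2 - e3 + e4
  refine ⟨?_, ?_, ?_, ?_⟩
  · simpa using k0
  · simpa [hT₁] using k1
  · simpa [hT₂] using k2
  · simpa [hT₃] using k3

/-- An element vanishing under evaluation at the four points `(±s, ±u)` lies in the ideal generated
by `t₁² - s²` and `t₂² - u²`. -/
theorem exists_eq_of_eval_eq_zero [Nontrivial B] (h : IsTorusModel q θ₁ θ₂ τ T₁ T₂) (s u : ℂˣ)
    {x : QTorus q} (hx : ∀ s' u' : ℂˣ, (s' = s ∨ s' = -s) → (u' = u ∨ u' = -u) →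
      h.eval s' u' x = 0) :
    ∃ y z : QTorus q, x =
      (QTorus.gen q .t₁ * QTorus.gen q .t₁ - algebraMap ℂ _ ((s : ℂ) ^ 2)) * y +
      (QTorus.gen q .t₂ * QTorus.gen q .t₂ - algebraMap ℂ _ ((u : ℂ) ^ 2)) * z := by
  obtain ⟨c₀, c₁, c₂, c₃, y, z, hxe⟩ := QTorus.exists_eq_add_mul q
    (pow_ne_zero 2 s.ne_zero) (pow_ne_zero 2 u.ne_zero) x
  have hc : c₀ = 0 ∧ c₁ = 0 ∧ c₂ = 0 ∧ c₃ = 0 := by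
    refine h.eq_zero_of_forall_signs s u fun s' u' hs hu => ?_
    have hs2 : (s' : ℂ) * s' = (s : ℂ) ^ 2 := by
      rcases hs with rfl | rfl <;> simp [sq]
    have hu2 : (u' : ℂ) * u' = (u : ℂ) ^ 2 := by
      rcases hu with rfl | rfl <;> simp [sq]
    have := hx s' u' hs hu
    rw [hxe] at this
    simpa [eval_gen, genImage, smul_smul, mul_comm (s' : ℂ), h.sq₁, h.sq₂, hs2, hu2,
      Algebra.algebraMap_eq_smul_one] using this
  obtain ⟨rfl, rfl, rfl, rfl⟩ := hc
  refine ⟨y, z, ?_⟩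
  simpa using hxe

variable {n : ℕ} {ρ : ℤˣ}

/-- The annihilator quotients of finite-dimensional irreducible modules over the unitary Lie algebra
of the quantum torus, in terms of a model of its simple quotients. -/
theorem exists_quotient_equiv_directSum [Nontrivial B] (h : IsTorusModel q θ₁ θ₂ τ T₁ T₂)
    (hn : 3 ≤ n) (hB : IsHypSimple τ n ρ) {S : Type*} [LieRing S] [LieAlgebra ℂ S]
    (e : gLie τ n ρ ≃ₗ⁅ℂ⁆ S) (V : Type*) [AddCommGroup V] [Module ℂ V]
    [LieRingModule (gLie (QTorus.involution q θ₁ θ₂) n ρ) V]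
    [LieModule ℂ (gLie (QTorus.involution q θ₁ θ₂) n ρ) V] [FiniteDimensional ℂ V]
    [LieModule.IsIrreducible ℂ (gLie (QTorus.involution q θ₁ θ₂) n ρ) V] :
    ∃ k : ℕ, Nonempty ((gLie (QTorus.involution q θ₁ θ₂) n ρ ⧸
      LieModule.ker ℂ (gLie (QTorus.involution q θ₁ θ₂) n ρ) V) ≃ₗ⁅ℂ⁆
        DirectSum (Fin k) fun _ => S) := by
  classical
  set K := LieModule.ker ℂ (gLie (QTorus.involution q θ₁ θ₂) n ρ) V with hKdef
  have hK : ∀ D : LieIdeal ℂ (gLie (QTorus.involution q θ₁ θ₂) n ρ), (∀ x ∈ D, ∀ y ∈ D, ⁅x, y⁆ ∈ K) → D ≤ K :=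
    LieModule.le_ker_of_isIrreducible (trace_toEnd_gLie_eq_zero V hn)
  have hI := K.isLieIdealIn_matrices
  have hl : ∀ a, ∀ b ∈ coeffIdeal (QTorus.involution q θ₁ θ₂) ρ K.matrices, a * b ∈ coeffIdeal (QTorus.involution q θ₁ θ₂) ρ K.matrices :=
    fun a b hb => mul_mem_coeffIdeal_left hn hI hb a
  obtain ⟨f, hf⟩ := exists_ker_le_coeffIdeal V hn (σ := QTorus.involution q θ₁ θ₂) (ρ := ρ)
  obtain ⟨S₁, hS₁, hm₁⟩ := exists_finset_aeval_prod_mem hK hn f hf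
    (QTorus.t₁_sq_mem_centralFixed q θ₁ θ₂)
    (w := QTorus.gen q .t₁inv * QTorus.gen q .t₁inv) (by
      rw [mul_assoc, ← mul_assoc (QTorus.gen q .t₁inv) (QTorus.gen q .t₁), QTorus.t₁_inv_mul,
        one_mul, QTorus.t₁_inv_mul])
  obtain ⟨S₂, hS₂, hm₂⟩ := exists_finset_aeval_prod_mem hK hn f hf
    (QTorus.t₂_sq_mem_centralFixed q θ₁ θ₂)
    (w := QTorus.gen q .t₂inv * QTorus.gen q .t₂inv) (by
      rw [mul_assoc, ← mul_assoc (QTorus.gen q .t₂inv) (QTorus.gen q .t₂), QTorus.t₂_inv_mul,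
        one_mul, QTorus.t₂_inv_mul])
  have hroot : ∀ α : ℂ, ∃ s : ℂˣ, α ≠ 0 → (s : ℂ) ^ 2 = α := by
    intro α
    by_cases hα : α = 0
    · exact ⟨1, fun h => absurd hα h⟩
    · obtain ⟨s, hs⟩ := IsAlgClosed.exists_pow_nat_eq α (n := 2) (by norm_num)
      have hs0 : s ≠ 0 := by
        rintro rfl
        exact hα (by rw [← hs]; norm_num)
      exact ⟨Units.mk0 s hs0, fun _ => hs⟩
  choose root hroot using hroot
  -- Both square roots of every root are needed to have all four points (±s, ±u) at hand.
  let P₁ : Finset ℂˣ := S₁.image root ∪ S₁.image fun α => -root α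
  let P₂ : Finset ℂˣ := S₂.image root ∪ S₂.image fun α => -root α
  let ψ : ℂˣ × ℂˣ → gLie (QTorus.involution q θ₁ θ₂) n ρ →ₗ⁅ℂ⁆ S := fun p =>
    e.toLieHom.comp (gLieMap (h.eval p.1 p.2) (h.eval_bar p.1 p.2) n ρ)
  have hψ : ∀ p x, ψ p x = e (gLieMap (h.eval p.1 p.2) (h.eval_bar p.1 p.2) n ρ x) :=
    fun _ _ => rfl
  have hψ0 : ∀ p x, ψ p x = 0 ↔ gLieMap (h.eval p.1 p.2) (h.eval_bar p.1 p.2) n ρ x = 0 := by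
    intro p x
    rw [hψ]
    exact map_eq_zero_iff e e.injective
  have hker : ∀ p, (ψ p).ker = (gLieMap (h.eval p.1 p.2) (h.eval_bar p.1 p.2) n ρ).ker := by
    intro p
    ext x
    rw [LieHom.mem_ker, LieHom.mem_ker, hψ0]
  refine LieIdeal.exists_quotient_equiv_directSum K hK ψ (fun p => ?_) (fun p J hJ => ?_)
    (P₁ ×ˢ P₂) (fun x hx => ?_)
  · exact e.surjective.comp (gLieMap_surjective _ _ (h.eval_surjective p.1 p.2))
  · rw [hker] at hJ ⊢
    exact sup_ker_gLieMap_eq_top _ _ hn hB (h.eval_surjective p.1 p.2) J hJ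
  refine mem_of_entries_mem hK hn fun r t => ?_
  have hzero : ∀ s u : ℂˣ, s ∈ P₁ → u ∈ P₂ → h.eval s u (x.1 r t) = 0 := by
    intro s u hs hu
    have := (hψ0 (s, u) x).1 (hx (s, u) (Finset.mem_product.2 ⟨hs, hu⟩))
    have h2 : x.1.map (h.eval s u) = 0 := congrArg Subtype.val this
    exact congrFun (congrFun h2 r) t
  have hmem : ∀ (T : Finset ℂ) (α : ℂ), α ∈ T → ∀ s : ℂˣ, s = root α ∨ s = -root α →
      s ∈ T.image root ∪ T.image fun α => -root α := by
    rintro T α hα s (rfl | rfl)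
    · exact Finset.mem_union_left _ (Finset.mem_image_of_mem _ hα)
    · exact Finset.mem_union_right _ (Finset.mem_image_of_mem (fun α => -root α) hα)
  -- Interpolation is applied twice: in t₁² modulo the coefficient ideal, then, for each root α, in
  -- t₂² modulo the larger ideal `I'`, which adds the multiples of t₁² - α.
  refine mem_of_forall_sub_mul_mem hl (fun y => mul_mem_coeffIdeal_right hn hI hm₁ y)
    fun α hα => ?_
  have hα0 : α ≠ 0 := fun e => hS₁ (e ▸ hα)
  set Z := QTorus.gen q .t₁ * QTorus.gen q .t₁ - algebraMap ℂ (QTorus q) α with hZ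
  have hZc : ∀ a, a * Z = Z * a := fun a => by
    rw [hZ, mul_sub, sub_mul, QTorus.t₁_sq_mul, Algebra.commutes]
  let I' := coeffIdeal (QTorus.involution q θ₁ θ₂) ρ K.matrices ⊔ LinearMap.range (LinearMap.mulLeft ℂ Z)
  have hx' : x.1 r t ∈ I' := by
    refine mem_of_forall_sub_mul_mem (I := I') (fun a b hb => ?_)
      (fun y => Submodule.mem_sup_left (mul_mem_coeffIdeal_right hn hI hm₂ y)) fun β hβ => ?_
    · obtain ⟨b', hb', -, ⟨c, rfl⟩, rfl⟩ := Submodule.mem_sup.1 hb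
      rw [mul_add, LinearMap.mulLeft_apply, ← mul_assoc, hZc, mul_assoc]
      exact add_mem (Submodule.mem_sup_left (hl a b' hb')) (Submodule.mem_sup_right ⟨_, rfl⟩)
    · have hβ0 : β ≠ 0 := fun e => hS₂ (e ▸ hβ)
      obtain ⟨y, z, hyz⟩ := h.exists_eq_of_eval_eq_zero (root α) (root β)
        fun s' u' hs hu => hzero s' u' (hmem S₁ α hα s' hs) (hmem S₂ β hβ u' hu)
      rw [hroot α hα0, hroot β hβ0] at hyz
      refine ⟨z, Submodule.mem_sup_right ⟨y, ?_⟩⟩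
      rw [hyz, add_sub_cancel_right]
      rfl
  obtain ⟨a, ha, -, ⟨y, rfl⟩, hay⟩ := Submodule.mem_sup.1 hx'
  refine ⟨y, ?_⟩
  rw [← hay, LinearMap.mulLeft_apply, add_sub_cancel_right]
  exact ha

end IsTorusModel

/-! ### Membership criteria for the unitary Lie algebra -/

section Membership

variable {k R : Type*} [Field k] [CharZero k] {ρ : ℤˣ} {n : ℕ}

/-- The off-diagonal part of a skew matrix is always in the Lie algebra, so only the diagonal is an
obstruction. -/
theorem mem_gLie_of_sum_uMat_mem [Ring R] [Algebra k R] {σ : AlgInvolution k R}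
    {X : Matrix (Fin n ⊕ Fin n) (Fin n ⊕ Fin n) R} (hX : X ∈ skewLie σ ρ n)
    (h : ∑ r, uMat σ ρ r r (X r r) ∈ gLie σ n ρ) : X ∈ gLie σ n ρ := by
  classical
  refine mem_of_two_nsmul_mem (gLie σ n ρ).toSubmodule ?_
  have : ∑ r, ∑ s, uMat σ ρ r s (X r s) = ∑ r, uMat σ ρ r r (X r r) +
      ∑ r, ∑ s ∈ Finset.univ.erase r, uMat σ ρ r s (X r s) := by
    rw [← Finset.sum_add_distrib]
    exact Finset.sum_congr rfl fun r _ =>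
      (Finset.add_sum_erase _ (fun s => uMat σ ρ r s (X r s)) (Finset.mem_univ r)).symm
  rw [two_smul_eq_sum_uMat σ ρ hX, this]
  exact add_mem h (sum_mem fun r _ => sum_mem fun s hs =>
    uMat_mem_gLie σ ρ (Finset.ne_of_mem_erase hs).symm _)

/-- Over a commutative algebra, `𝔤_{2n,ρ}` consists of the trace-free skew matrices. -/
theorem mem_gLie_iff_of_comm [CommRing R] [Algebra k R] {σ : AlgInvolution k R} (hn : 3 ≤ n)
    {X : Matrix (Fin n ⊕ Fin n) (Fin n ⊕ Fin n) R} :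
    X ∈ gLie σ n ρ ↔ X ∈ skewLie σ ρ n ∧ X.trace = 0 := by
  constructor
  · intro hX
    refine ⟨gLie_le_skewLie σ ρ hX, ?_⟩
    let L : LieSubalgebra k (Matrix (Fin n ⊕ Fin n) (Fin n ⊕ Fin n) R) :=
      { LinearMap.ker (Matrix.traceLinearMap (Fin n ⊕ Fin n) k R) with
        lie_mem' := fun {x y} _ _ => by
          change (⁅x, y⁆ : Matrix (Fin n ⊕ Fin n) (Fin n ⊕ Fin n) R).trace = 0
          rw [Ring.lie_def, Matrix.trace_sub, Matrix.trace_mul_comm, sub_self] }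
    refine gLie_le σ ρ (L := L) (fun r s a hrs => ?_) hX
    change (uMat σ ρ r s a).trace = 0
    rw [uMat_apply, Matrix.trace_sub, Matrix.trace_single_eq_of_ne _ _ _ hrs,
      Matrix.trace_single_eq_of_ne _ _ _ (swap_ne_swap hrs.symm), sub_zero]
  · rintro ⟨hX, htr⟩
    refine mem_gLie_of_sum_uMat_mem hX ?_
    have h1 : ∀ r s : Fin n ⊕ Fin n, hypBase r ≠ hypBase s → ∀ a,
        uMat σ ρ r r a - uMat σ ρ s s a ∈ gLie σ n ρ := by
      intro r s hrs a
      have := (gLie σ n ρ).lie_mem (uMat_mem_gLie σ ρ (ne_of_hypBase_ne hrs) a)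
        (uMat_mem_gLie σ ρ (ne_of_hypBase_ne hrs.symm) 1)
      rwa [uMat_lie_uMat_self _ _ hrs, one_mul, mul_one] at this
    let r₀ : Fin n ⊕ Fin n := .inl ⟨0, by omega⟩
    have h2 : ∀ r, uMat σ ρ r r (X r r) - uMat σ ρ r₀ r₀ (X r r) ∈ gLie σ n ρ := by
      intro r
      obtain ⟨t, ht, ht'⟩ := exists_hypBase_ne hn r r₀
      have := add_mem (h1 r t ht.symm (X r r)) (h1 t r₀ ht' (X r r))
      rwa [sub_add_sub_cancel] at this
    have h3 := sum_mem (t := Finset.univ) fun r _ => h2 r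
    have h4 : ∑ r, X r r = 0 := htr
    rwa [Finset.sum_sub_distrib, ← map_sum, h4, map_zero, sub_zero] at h3

/-- With trivial involution the diagonal entries at r and r' are opposite, so the trace condition is
automatic. -/
theorem gLie_identity_eq_skewLie (hn : 3 ≤ n) (ρ : ℤˣ) :
    gLie (AlgInvolution.identity k k) n ρ = skewLie (AlgInvolution.identity k k) ρ n := by
  ext X
  refine (mem_gLie_iff_of_comm hn).trans ⟨And.left, fun h => ⟨h, ?_⟩⟩
  have h1 : X.trace = -X.trace := by
    rw [Matrix.trace, ← Finset.sum_neg_distrib, ← Equiv.sum_comp (Equiv.sumComm (Fin n) (Fin n))]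
    refine Finset.sum_congr rfl fun r _ => ?_
    have := h r r
    rw [Int.units_mul_self, Units.val_one, one_smul] at this
    exact this
  exact self_eq_neg.1 h1

end Membership

/-! ### The exchange model and the special linear algebra -/

section Exchange

/-- The exchange involution of `R × R`. -/
def AlgInvolution.exchange (k R : Type*) [CommRing k] [CommRing R] [Algebra k R] :
    AlgInvolution k (R × R) where
  bar := (LinearEquiv.prodComm k R R).toLinearMap
  bar_mul a b := by
    ext <;> exact mul_comm _ _
  bar_bar _ := rfl

theorem AlgInvolution.exchange_bar {k R : Type*} [CommRing k] [CommRing R] [Algebra k R]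
    (a : R × R) : (AlgInvolution.exchange k R).bar a = a.swap := rfl

variable {k : Type*} [Field k] [CharZero k] {n : ℕ}

theorem isHypSimple_exchange (hn : 3 ≤ n) (ρ : ℤˣ) :
    IsHypSimple (AlgInvolution.exchange k k) n ρ where
  eq_bot_or_one_mem U hl _ hb := by
    by_contra! h
    obtain ⟨h0, h1⟩ := h
    obtain ⟨a, ha, ha0⟩ := (Submodule.ne_bot_iff _).1 h0
    have key : ∀ a ∈ U, a.1 ≠ 0 → (1 : k × k) ∈ U := by
      intro a ha ha0
      have h2 := hl a ha (a.1⁻¹, 0)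
      have h3 : (a.1⁻¹, (0 : k)) * a = (1, 0) := by
        ext <;> simp [ha0]
      rw [h3] at h2
      have h4 := add_mem h2 (hb _ h2)
      have h5 : ((1 : k), (0 : k)) + (AlgInvolution.exchange k k).bar (1, 0) = 1 := by
        rw [AlgInvolution.exchange_bar]
        ext <;> simp
      rwa [h5] at h4
    by_cases h2 : a.1 = 0
    · refine h1 (key _ (hb a ha) fun h3 => ha0 (Prod.ext h2 h3))
    · exact h1 (key a ha h2)
  eq_zero c _ _ hc := by
    -- Skew scalars (c, -c) do exist here; they are excluded because their trace 2n c must vanish.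
    have := ((mem_gLie_iff_of_comm hn).1 hc).2
    rw [Matrix.trace_diagonal, Finset.sum_const, Finset.card_univ, ← Nat.cast_smul_eq_nsmul k] at this
    refine (smul_eq_zero.1 this).resolve_left ?_
    rw [Nat.cast_eq_zero, Fintype.card_sum, Fintype.card_fin]
    omega

/-- The Lie algebra `𝔤_{2n,ρ}` of `k × k` with the exchange involution is `𝔰𝔩_{2n}(k)`. -/
theorem nonempty_gLie_exchange_equiv_sl (hn : 3 ≤ n) (ρ : ℤˣ) :
    Nonempty (gLie (AlgInvolution.exchange k k) n ρ ≃ₗ⁅k⁆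
      LieAlgebra.SpecialLinear.sl (Fin (2 * n)) k) := by
  let e : Fin n ⊕ Fin n ≃ Fin (2 * n) := finSumFinEquiv.trans (finCongr (two_mul n).symm)
  -- Skewness determines the second coordinates from the first, so projecting to the first
  -- coordinate loses nothing.
  let Φ : Matrix (Fin n ⊕ Fin n) (Fin n ⊕ Fin n) (k × k) →ₐ[k]
      Matrix (Fin (2 * n)) (Fin (2 * n)) k :=
    (Matrix.reindexAlgEquiv k k e).toAlgHom.comp (AlgHom.fst k k k).mapMatrix
  have hΦ : ∀ X r s, Φ X (e r) (e s) = (X r s).1 := by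
    intro X r s
    simp [Φ]
  have htr : ∀ X, (Φ X).trace = X.trace.1 := by
    intro X
    rw [Matrix.trace, ← Equiv.sum_comp e]
    simp only [Matrix.diag_apply, hΦ]
    exact (map_sum (AddMonoidHom.fst k k) _ _).symm
  let Ψ : gLie (AlgInvolution.exchange k k) n ρ →ₗ⁅k⁆
      LieAlgebra.SpecialLinear.sl (Fin (2 * n)) k :=
    { toFun := fun X => ⟨Φ X.1, by
        change (Φ X.1).trace = 0
        rw [htr, ((mem_gLie_iff_of_comm hn).1 X.2).2]
        rfl⟩
      map_add' := fun X Y => Subtype.ext (map_add Φ X.1 Y.1)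
      map_smul' := fun c X => Subtype.ext (map_smul Φ c X.1)
      map_lie' := fun {X Y} => Subtype.ext (LieHom.map_lie Φ.toLieHom X.1 Y.1) }
  have hinj : Function.Injective Ψ := by
    intro X Y hXY
    have h1 : Φ X.1 = Φ Y.1 := congrArg Subtype.val hXY
    have h2 : ∀ r s, (X.1 r s).1 = (Y.1 r s).1 := fun r s => by rw [← hΦ, h1, hΦ]
    have h3 : ∀ (Z : gLie (AlgInvolution.exchange k k) n ρ) r s, (Z.1 r s).2 =
        -(((hypSign ρ s.swap * hypSign ρ r.swap : ℤˣ) : ℤ) • (Z.1 s.swap r.swap).1) := by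
      intro Z r s
      have := gLie_le_skewLie _ _ Z.2 s.swap r.swap
      rw [Sum.swap_swap, Sum.swap_swap] at this
      rw [this]
      rfl
    apply Subtype.ext
    ext r s
    · exact h2 r s
    · rw [h3, h3, h2]
  have hsurj : Function.Surjective Ψ := by
    rintro ⟨Y, hY⟩
    let X : Matrix (Fin n ⊕ Fin n) (Fin n ⊕ Fin n) (k × k) := Matrix.of fun r s =>
      (Y (e r) (e s), -(((hypSign ρ r * hypSign ρ s : ℤˣ) : ℤ) • Y (e s.swap) (e r.swap)))
    have hX : ∀ r s, X r s =
      (Y (e r) (e s), -(((hypSign ρ r * hypSign ρ s : ℤˣ) : ℤ) • Y (e s.swap) (e r.swap))) :=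
        fun _ _ => rfl
    have hXY : Φ X = Y := by
      ext a b
      rw [← e.apply_symm_apply a, ← e.apply_symm_apply b, hΦ]
      rfl
    have hskew : X ∈ skewLie (AlgInvolution.exchange k k) ρ n := by
      intro r s
      rw [AlgInvolution.exchange_bar, hX, hX, Sum.swap_swap, Sum.swap_swap, hypSign_swap,
        hypSign_swap]
      rcases Int.units_eq_one_or (hypSign ρ r) with hr | hr <;>
      rcases Int.units_eq_one_or (hypSign ρ s) with hs | hs <;>
      rcases Int.units_eq_one_or ρ with rfl | rfl <;>
      simp [hr, hs]
    have htr1 : X.trace.1 = 0 := by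
      rw [← htr, hXY]
      exact hY
    have htr2 : X.trace.2 = 0 := by
      have : X.trace.2 = -X.trace.1 := by
        have h1 : X.trace.2 = ∑ r, (X r r).2 := map_sum (AddMonoidHom.snd k k) _ _
        have h2 : X.trace.1 = ∑ r, (X r r).1 := map_sum (AddMonoidHom.fst k k) _ _
        rw [h1, h2, ← Finset.sum_neg_distrib,
          ← Equiv.sum_comp (Equiv.sumComm (Fin n) (Fin n)) fun r => -(X r r).1]
        refine Finset.sum_congr rfl fun r _ => ?_
        rw [hX, hX, Int.units_mul_self, Units.val_one, one_smul]
        rfl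
      rw [this, htr1, neg_zero]
    exact ⟨⟨X, (mem_gLie_iff_of_comm hn).2 ⟨hskew, Prod.ext htr1 htr2⟩⟩, Subtype.ext hXY⟩
  exact ⟨LieEquiv.ofBijective Ψ ⟨hinj, hsurj⟩⟩

/-- The exchange fixes (1, 1) and negates (1, -1), so one choice of T₁ serves either sign θ₁.
Already 1 and T₂ span, hence the zero coefficients. -/
theorem isTorusModel_exchange {θ₁ : ℤˣ} :
    IsTorusModel 1 θ₁ (-1) (AlgInvolution.exchange ℂ ℂ) (1, ((θ₁ : ℤ) : ℂ)) (1, -1) where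
  sq₁ := by rcases Int.units_eq_one_or θ₁ with rfl | rfl <;> ext <;> simp
  sq₂ := by ext <;> simp
  comm := by ext <;> simp
  bar₁ := by
    rw [AlgInvolution.exchange_bar]
    rcases Int.units_eq_one_or θ₁ with rfl | rfl <;> ext <;> simp
  bar₂ := by
    rw [AlgInvolution.exchange_bar]
    ext <;> simp
  span b := by
    refine ⟨(b.1 + b.2) / 2, 0, (b.1 - b.2) / 2, 0, ?_⟩
    ext <;> simp <;> ring

end Exchange

/-! ### Matrix algebras with orthogonal or symplectic involution -/

section MatrixModel

open Matrix

/-- The involution `X ↦ C Xᵀ C⁻¹` of a matrix algebra, where `Cᵀ = ε C`. -/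
def AlgInvolution.matrix {k : Type*} [Field k] {m : ℕ} (ε : ℤˣ) (C D : Matrix (Fin m) (Fin m) k)
    (hCD : C * D = 1) (hC : Cᵀ = (ε : ℤ) • C) (hD : Dᵀ = (ε : ℤ) • D) :
    AlgInvolution k (Matrix (Fin m) (Fin m) k) where
  bar :=
    { toFun := fun X => C * (Xᵀ * D)
      map_add' := fun X Y => by rw [Matrix.transpose_add, add_mul, mul_add]
      map_smul' := fun c X => by
        rw [Matrix.transpose_smul, smul_mul_assoc, mul_smul_comm, RingHom.id_apply] }
  bar_mul a b := by
    have hDC : D * C = 1 := mul_eq_one_comm.1 hCD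
    change C * ((a * b)ᵀ * D) = C * (bᵀ * D) * (C * (aᵀ * D))
    calc C * ((a * b)ᵀ * D) = C * bᵀ * 1 * aᵀ * D := by
          rw [Matrix.transpose_mul]
          simp only [mul_one, mul_assoc]
      _ = C * (bᵀ * D) * (C * (aᵀ * D)) := by rw [← hDC]; simp only [mul_assoc]
  bar_bar a := by
    have hDC : D * C = 1 := mul_eq_one_comm.1 hCD
    change C * ((C * (aᵀ * D))ᵀ * D) = a
    rw [Matrix.transpose_mul, Matrix.transpose_mul, Matrix.transpose_transpose, hC, hD]
    simp only [smul_mul_assoc, mul_smul_comm, smul_smul, ← Units.val_mul, Int.units_mul_self,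
      Units.val_one, one_smul]
    calc C * (D * a * C * D) = C * D * a * (C * D) := by simp only [mul_assoc]
      _ = a := by rw [hCD, one_mul, mul_one]

variable {k : Type*} [Field k] {m : ℕ} {ε : ℤˣ} {C D : Matrix (Fin m) (Fin m) k}
  {hCD : C * D = 1} {hC : Cᵀ = (ε : ℤ) • C} {hD : Dᵀ = (ε : ℤ) • D}

theorem AlgInvolution.matrix_bar (X : Matrix (Fin m) (Fin m) k) :
    (AlgInvolution.matrix ε C D hCD hC hD).bar X = C * (Xᵀ * D) := rfl

variable {n : ℕ} {ρ : ℤˣ} [CharZero k]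

/-- Matrix algebras are simple with scalar centre, and this involution fixes scalars, so a skew one
is zero. -/
theorem isHypSimple_matrix : IsHypSimple (AlgInvolution.matrix ε C D hCD hC hD) n ρ where
  eq_bot_or_one_mem U hl hr _ := by
    by_contra! h
    obtain ⟨h0, h1⟩ := h
    obtain ⟨a, ha, ha0⟩ := (Submodule.ne_bot_iff _).1 h0
    obtain ⟨i, j, hij⟩ : ∃ i j, a i j ≠ 0 := by
      by_contra! h
      exact ha0 (Matrix.ext h)
    refine h1 ?_
    have h2 : ∀ l : Fin m, Matrix.single l l (1 : k) ∈ U := by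
      intro l
      have h3 := hr _ (hl a ha (Matrix.single l i (a i j)⁻¹)) (Matrix.single j l 1)
      rwa [Matrix.single_mul_mul_single, inv_mul_cancel₀ hij, mul_one] at h3
    rw [← Matrix.sum_single_one]
    exact sum_mem fun l _ => h2 l
  eq_zero c hc hbar _ := by
    obtain ⟨z, rfl⟩ : c ∈ Set.range (Matrix.scalar (Fin m)) :=
      Matrix.mem_range_scalar_iff_commute_single'.2 fun i j => (hc _).symm
    have h1 : (AlgInvolution.matrix ε C D hCD hC hD).bar (Matrix.scalar (Fin m) z) =
        Matrix.scalar (Fin m) z := by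
      rw [AlgInvolution.matrix_bar, Matrix.scalar_apply, Matrix.diagonal_transpose,
        ← Matrix.smul_one_eq_diagonal, smul_mul_assoc, one_mul, mul_smul_comm, hCD]
    rw [h1] at hbar
    ext i j
    exact self_eq_neg.1 (congrFun (congrFun hbar i) j)

/-- The coefficients a with u_rr(a) in the Lie algebra include 1 and all commutators, which together
span the matrix algebra in characteristic zero. -/
theorem gLie_matrix_eq_skewLie (hn : 3 ≤ n) :
    gLie (AlgInvolution.matrix ε C D hCD hC hD) n ρ =
      skewLie (AlgInvolution.matrix ε C D hCD hC hD) ρ n := by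
  set τ := AlgInvolution.matrix ε C D hCD hC hD
  refine le_antisymm (gLie_le_skewLie τ ρ) fun X hX => mem_gLie_of_sum_uMat_mem hX ?_
  refine sum_mem fun r _ => ?_
  let U : Submodule k (Matrix (Fin m) (Fin m) k) :=
    (gLie τ n ρ).toSubmodule.comap (uMat τ ρ r r)
  have hcomm : ∀ a b, a * b - b * a ∈ U := fun a b => uMat_self_bracket_mem_gLie τ ρ hn r a b
  have hone : (1 : Matrix (Fin m) (Fin m) k) ∈ U := uMat_self_one_mem_gLie hn r
  have hoff : ∀ i j, i ≠ j → Matrix.single i j (1 : k) ∈ U := by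
    intro i j hij
    have := hcomm (Matrix.single i i 1) (Matrix.single i j 1)
    rwa [Matrix.single_mul_single_same, Matrix.single_mul_single_of_ne _ _ _ _ hij.symm, sub_zero,
      one_mul] at this
  have hdiff : ∀ i j, Matrix.single i i (1 : k) - Matrix.single j j 1 ∈ U := by
    intro i j
    have := hcomm (Matrix.single i j 1) (Matrix.single j i 1)
    rwa [Matrix.single_mul_single_same, Matrix.single_mul_single_same, one_mul] at this
  have hdiag : ∀ i, Matrix.single i i (1 : k) ∈ U := by
    intro i
    have h1 := sum_mem (t := Finset.univ) fun j _ => hdiff i j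
    rw [Finset.sum_sub_distrib, Matrix.sum_single_one] at h1
    have h2 := add_mem h1 hone
    rw [sub_add_cancel, Finset.sum_const, Finset.card_univ, Fintype.card_fin,
      ← Nat.cast_smul_eq_nsmul k] at h2
    have hm : (m : k) ≠ 0 := Nat.cast_ne_zero.2 (Fin.pos i).ne'
    exact (U.smul_mem_iff hm).1 h2
  have hall : ∀ a, a ∈ U := by
    intro a
    rw [Matrix.matrix_eq_sum_single a]
    refine sum_mem fun i _ => sum_mem fun j _ => ?_
    rw [← mul_one (a i j), ← smul_eq_mul, ← Matrix.smul_single]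
    refine U.smul_mem _ ?_
    by_cases hij : i = j
    · rw [hij]
      exact hdiag j
    · exact hoff i j hij
  exact hall _

/-- The bijection from the double indices of `2n × 2n` matrices with `m × m` matrix entries to the
indices of `2mn × 2mn` matrices. -/
def hypFlatten (n m : ℕ) : (Fin n ⊕ Fin n) × Fin m ≃ Fin (m * n) ⊕ Fin (m * n) :=
  (Equiv.sumProdDistrib _ _ _).trans (Equiv.sumCongr
    ((Equiv.prodComm _ _).trans finProdFinEquiv) ((Equiv.prodComm _ _).trans finProdFinEquiv))

theorem hypFlatten_swap (r : Fin n ⊕ Fin n) (a : Fin m) :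
    hypFlatten n m (r.swap, a) = (hypFlatten n m (r, a)).swap := by
  cases r <;> rfl

theorem hypSign_hypFlatten (ρ : ℤˣ) (r : Fin n ⊕ Fin n) (a : Fin m) :
    hypSign ρ (hypFlatten n m (r, a)) = hypSign ρ r := by
  cases r <;> rfl

/-- The Lie algebra `𝔤_{2n,ρ}` of a matrix algebra of size `m` with involution of sign `ε` is
`𝔤_{2mn,ερ}` of the base field. -/
theorem nonempty_gLie_matrix_equiv (hm : 1 ≤ m) (hn : 3 ≤ n) :
    Nonempty (gLie (AlgInvolution.matrix ε C D hCD hC hD) n ρ ≃ₗ⁅k⁆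
      gLie (AlgInvolution.identity k k) (m * n) (ε * ρ)) := by
  set τ := AlgInvolution.matrix ε C D hCD hC hD with hτ
  have hDC : D * C = 1 := mul_eq_one_comm.1 hCD
  -- Conjugation by diag(1, C⁻¹) absorbs C into the hyperbolic form, turning the block involution
  -- into plain transposition.
  let P : Fin n ⊕ Fin n → Matrix (Fin m) (Fin m) k := Sum.elim (fun _ => 1) fun _ => C
  let Q : Fin n ⊕ Fin n → Matrix (Fin m) (Fin m) k := Sum.elim (fun _ => 1) fun _ => D
  have hPQ : ∀ r, P r * Q r = 1 := by rintro (r | r) <;> simp [P, Q, hCD]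
  have hQP : ∀ r, Q r * P r = 1 := by rintro (r | r) <;> simp [P, Q, hDC]
  let u : (Matrix (Fin n ⊕ Fin n) (Fin n ⊕ Fin n) (Matrix (Fin m) (Fin m) k))ˣ :=
    { val := Matrix.diagonal Q
      inv := Matrix.diagonal P
      val_inv := by simp only [Matrix.diagonal_mul_diagonal, hQP, Matrix.diagonal_one]
      inv_val := by simp only [Matrix.diagonal_mul_diagonal, hPQ, Matrix.diagonal_one] }
  let conj : Matrix (Fin n ⊕ Fin n) (Fin n ⊕ Fin n) (Matrix (Fin m) (Fin m) k) ≃ₐ[k]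
      Matrix (Fin n ⊕ Fin n) (Fin n ⊕ Fin n) (Matrix (Fin m) (Fin m) k) :=
    MulSemiringAction.toAlgEquiv k _ (ConjAct.toConjAct u)
  have hconj : ∀ X r s, conj X r s = Q r * X r s * P s := by
    intro X r s
    change (Matrix.diagonal Q * X * Matrix.diagonal P) r s = _
    rw [Matrix.mul_diagonal, Matrix.diagonal_mul]
  let Φ := (conj.trans (Matrix.compAlgEquiv (Fin n ⊕ Fin n) (Fin m) k k)).trans
    (Matrix.reindexAlgEquiv k k (hypFlatten n m))
  have hΦ : ∀ X r s a b, Φ X (hypFlatten n m (r, a)) (hypFlatten n m (s, b)) =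
      (Q r * X r s * P s) a b := by
    intro X r s a b
    simp [Φ, hconj]
  -- Moving C and D past the transpose costs a sign ε on the last half of the indices, which turns ρ
  -- into ερ.
  let η : Fin n ⊕ Fin n → ℤˣ := Sum.elim (fun _ => 1) fun _ => ε
  have hηsign : ∀ r, hypSign (ε * ρ) r = η r * hypSign ρ r := by
    rintro (r | r) <;> simp [hypSign, η]
  have hQC : ∀ s, Q s.swap * C = (η s : ℤ) • (P s)ᵀ := by
    rintro (s | s)
    · simp [Q, P, η, hDC]
    · change 1 * C = (ε : ℤ) • Cᵀ
      rw [one_mul, hC, smul_smul, ← Units.val_mul, Int.units_mul_self, Units.val_one, one_smul]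
  have hDP : ∀ r, D * P r.swap = (η r : ℤ) • (Q r)ᵀ := by
    rintro (r | r)
    · simp [Q, P, η, hDC]
    · change D * 1 = (ε : ℤ) • Dᵀ
      rw [mul_one, hD, smul_smul, ← Units.val_mul, Int.units_mul_self, Units.val_one, one_smul]
  have key : ∀ X, X ∈ skewLie τ ρ n ↔
      Φ X ∈ skewLie (AlgInvolution.identity k k) (ε * ρ) (m * n) := by
    intro X
    have hblock : ∀ r s, X s.swap r.swap =
        -(((hypSign ρ r * hypSign ρ s : ℤˣ) : ℤ) • τ.bar (X r s)) ↔
        Q s.swap * X s.swap r.swap * P r.swap =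
        -(((hypSign (ε * ρ) r * hypSign (ε * ρ) s : ℤˣ) : ℤ) • (Q r * X r s * P s)ᵀ) := by
      intro r s
      have h1 : -(((hypSign (ε * ρ) r * hypSign (ε * ρ) s : ℤˣ) : ℤ) • (Q r * X r s * P s)ᵀ) =
          Q s.swap * -(((hypSign ρ r * hypSign ρ s : ℤˣ) : ℤ) • τ.bar (X r s)) * P r.swap := by
        have h2 : Q s.swap * τ.bar (X r s) * P r.swap =
            ((η r * η s : ℤˣ) : ℤ) • (Q r * X r s * P s)ᵀ := by
          calc Q s.swap * (C * ((X r s)ᵀ * D)) * P r.swap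
              = (Q s.swap * C) * (X r s)ᵀ * (D * P r.swap) := by simp only [mul_assoc]
            _ = _ := by
              rw [hQC, hDP, Matrix.transpose_mul, Matrix.transpose_mul]
              simp only [smul_mul_assoc, mul_smul_comm, smul_smul, Units.val_mul, mul_assoc]
        rw [mul_neg, neg_mul, mul_smul_comm, smul_mul_assoc, h2, smul_smul, hηsign, hηsign]
        congr 2
        rw [← Units.val_mul]
        congr 1
        exact mul_mul_mul_comm _ _ _ _ |>.trans (mul_comm _ _)
      rw [h1]
      constructor
      · intro h
        rw [h]
      · intro h
        have h3 := congrArg (fun A => P s.swap * A * Q r.swap) h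
        have h4 : ∀ A, P s.swap * (Q s.swap * A * P r.swap) * Q r.swap = A := by
          intro A
          calc P s.swap * (Q s.swap * A * P r.swap) * Q r.swap
              = (P s.swap * Q s.swap) * A * (P r.swap * Q r.swap) := by simp only [mul_assoc]
            _ = A := by rw [hPQ, hPQ, one_mul, mul_one]
        simpa only [h4] using h3
    constructor
    · intro hX p q
      obtain ⟨⟨r, a⟩, rfl⟩ := (hypFlatten n m).surjective p
      obtain ⟨⟨s, b⟩, rfl⟩ := (hypFlatten n m).surjective q
      rw [← hypFlatten_swap, ← hypFlatten_swap, hΦ, hΦ, hypSign_hypFlatten, hypSign_hypFlatten,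
        (hblock r s).1 (hX r s)]
      rfl
    · intro hX r s
      refine (hblock r s).2 ?_
      ext b a
      have := hX (hypFlatten n m (r, a)) (hypFlatten n m (s, b))
      rw [← hypFlatten_swap, ← hypFlatten_swap, hΦ, hΦ, hypSign_hypFlatten,
        hypSign_hypFlatten] at this
      rw [this]
      rfl
  refine ⟨LieEquiv.ofSubalgebras _ _ Φ.toLieEquiv ?_⟩
  rw [gLie_matrix_eq_skewLie hn, gLie_identity_eq_skewLie (hn.trans (Nat.le_mul_of_pos_left n hm))]
  ext Y
  constructor
  · rintro ⟨X, hX, rfl⟩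
    exact (key X).1 hX
  · intro hY
    refine ⟨Φ.symm Y, (key _).2 ?_, Φ.apply_symm_apply Y⟩
    rwa [Φ.apply_symm_apply]

end MatrixModel

/-! ### Explicit models and the theorem -/

section Models

open Matrix

/-- The commutative torus with trivial involution specializes to `1 × 1` matrices. -/
theorem exists_isTorusModel_one : ∃ (C D : Matrix (Fin 1) (Fin 1) ℂ) (hCD : C * D = 1)
    (hC : Cᵀ = ((1 : ℤˣ) : ℤ) • C) (hD : Dᵀ = ((1 : ℤˣ) : ℤ) • D) (T₁ T₂ : Matrix (Fin 1) (Fin 1) ℂ),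
    IsTorusModel 1 1 1 (AlgInvolution.matrix 1 C D hCD hC hD) T₁ T₂ := by
  refine ⟨1, 1, one_mul 1, by simp, by simp, 1, 1, one_mul 1, one_mul 1, by simp, ?_, ?_,
    fun b => ⟨b 0 0, 0, 0, 0, ?_⟩⟩
  · simp [AlgInvolution.matrix_bar]
  · simp [AlgInvolution.matrix_bar]
  · ext i j
    fin_cases i
    fin_cases j
    simp

/-- The quantum torus at `q = -1` specializes to `2 × 2` matrices, with an orthogonal or symplectic
involution according to the sign `θ₁`. -/
theorem exists_isTorusModel_neg_one {θ₁ θ₂ : ℤˣ} (hP : ((-1 : ℤˣ), θ₁, θ₂) ∈ paramSet) :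
    ∃ (C D : Matrix (Fin 2) (Fin 2) ℂ) (hCD : C * D = 1) (hC : Cᵀ = (θ₁ : ℤ) • C)
      (hD : Dᵀ = (θ₁ : ℤ) • D) (T₁ T₂ : Matrix (Fin 2) (Fin 2) ℂ),
      IsTorusModel (-1) θ₁ θ₂ (AlgInvolution.matrix θ₁ C D hCD hC hD) T₁ T₂ := by
  have hcases : (θ₁ = 1 ∧ θ₂ = 1) ∨ (θ₁ = 1 ∧ θ₂ = -1) ∨ (θ₁ = -1 ∧ θ₂ = -1) := by
    simpa [paramSet] using hP
  have hspan : ∀ b : Matrix (Fin 2) (Fin 2) ℂ, ∃ c₀ c₁ c₂ c₃ : ℂ,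
      b = c₀ • 1 + c₁ • !![1, 0; 0, -1] + c₂ • !![0, 1; 1, 0] +
        c₃ • (!![1, 0; 0, -1] * !![0, 1; 1, 0]) := by
    intro b
    refine ⟨(b 0 0 + b 1 1) / 2, (b 0 0 - b 1 1) / 2, (b 0 1 + b 1 0) / 2, (b 0 1 - b 1 0) / 2, ?_⟩
    ext i j
    fin_cases i <;> fin_cases j <;> simp <;> ring
  rcases hcases with ⟨rfl, rfl⟩ | ⟨rfl, rfl⟩ | ⟨rfl, rfl⟩
  -- Two anticommuting symmetric Pauli matrices, under the transpose.
  · refine ⟨1, 1, one_mul 1, by simp, by simp, !![1, 0; 0, -1], !![0, 1; 1, 0], ?_, ?_, ?_, ?_, ?_,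
      hspan⟩
    · ext i j
      fin_cases i <;> fin_cases j <;> simp
    · ext i j
      fin_cases i <;> fin_cases j <;> simp
    · ext i j
      fin_cases i <;> fin_cases j <;> simp
    · rw [AlgInvolution.matrix_bar]
      ext i j
      fin_cases i <;> fin_cases j <;> simp
    · rw [AlgInvolution.matrix_bar]
      ext i j
      fin_cases i <;> fin_cases j <;> simp
  -- T₂ must now be skew-symmetric with square 1, hence the imaginary Pauli matrix.
  · refine ⟨1, 1, one_mul 1, by simp, by simp, !![1, 0; 0, -1],
      !![0, Complex.I; -Complex.I, 0], ?_, ?_, ?_, ?_, ?_, fun b => ?_⟩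
    · ext i j
      fin_cases i <;> fin_cases j <;> simp
    · ext i j
      fin_cases i <;> fin_cases j <;> simp
    · ext i j
      fin_cases i <;> fin_cases j <;> simp
    · rw [AlgInvolution.matrix_bar]
      ext i j
      fin_cases i <;> fin_cases j <;> simp
    · rw [AlgInvolution.matrix_bar]
      ext i j
      fin_cases i <;> fin_cases j <;> simp
    · have hI := Complex.I_mul_I
      refine ⟨(b 0 0 + b 1 1) / 2, (b 0 0 - b 1 1) / 2, -Complex.I * (b 0 1 - b 1 0) / 2,
        -Complex.I * (b 0 1 + b 1 0) / 2, ?_⟩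
      ext i j
      fin_cases i <;> fin_cases j <;> simp
      · ring
      · linear_combination (b 0 1) * hI
      · linear_combination (b 1 0) * hI
      · ring
  -- With this C the involution is the adjugate, which negates every trace-zero matrix, in
  -- particular T₁ and T₂.
  · refine ⟨!![0, 1; -1, 0], !![0, -1; 1, 0], ?_, ?_, ?_, !![1, 0; 0, -1], !![0, 1; 1, 0], ?_, ?_,
      ?_, ?_, ?_, hspan⟩
    · ext i j
      fin_cases i <;> fin_cases j <;> simp
    · ext i j
      fin_cases i <;> fin_cases j <;> simp
    · ext i j
      fin_cases i <;> fin_cases j <;> simp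
    · ext i j
      fin_cases i <;> fin_cases j <;> simp
    · ext i j
      fin_cases i <;> fin_cases j <;> simp
    · ext i j
      fin_cases i <;> fin_cases j <;> simp
    · rw [AlgInvolution.matrix_bar]
      ext i j
      fin_cases i <;> fin_cases j <;> simp [Matrix.mul_apply, Fin.sum_univ_two]
    · rw [AlgInvolution.matrix_bar]
      ext i j
      fin_cases i <;> fin_cases j <;> simp [Matrix.mul_apply, Fin.sum_univ_two]

end Models

theorem theorem5p2 (n : ℕ) (hn : 3 ≤ n) (ρ q θ₁ θ₂ : ℤˣ) (hP : (q, θ₁, θ₂) ∈ paramSet)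
    (V : Type*) [AddCommGroup V] [Module ℂ V]
    [LieRingModule (gLie (QTorus.involution q θ₁ θ₂) n ρ) V]
    [LieModule ℂ (gLie (QTorus.involution q θ₁ θ₂) n ρ) V]
    [FiniteDimensional ℂ V]
    [LieModule.IsIrreducible ℂ (gLie (QTorus.involution q θ₁ θ₂) n ρ) V]
    (hV : 2 ≤ Module.finrank ℂ V) :
    (q = -1 ∨ (q, θ₁, θ₂) = (1, 1, 1) →
      ∃ k : ℕ, Nonempty
        ((gLie (QTorus.involution q θ₁ θ₂) n ρ ⧸
            LieModule.ker ℂ (gLie (QTorus.involution q θ₁ θ₂) n ρ) V) ≃ₗ⁅ℂ⁆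
          (DirectSum (Fin k) fun _ => gLie (AlgInvolution.identity ℂ ℂ) (orderOf q * n) (θ₁ * ρ)))) ∧
    ((q, θ₁, θ₂) = (1, 1, -1) ∨ (q, θ₁, θ₂) = (1, -1, -1) →
      ∃ k : ℕ, Nonempty
        ((gLie (QTorus.involution q θ₁ θ₂) n ρ ⧸
            LieModule.ker ℂ (gLie (QTorus.involution q θ₁ θ₂) n ρ) V) ≃ₗ⁅ℂ⁆
          (DirectSum (Fin k) fun _ => LieAlgebra.SpecialLinear.sl (Fin (2 * n)) ℂ))) := by
  constructor
  · intro h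
    have hq : q = -1 ∨ q = 1 ∧ θ₁ = 1 ∧ θ₂ = 1 := by simpa using h
    rcases hq with rfl | ⟨rfl, rfl, rfl⟩
    · obtain ⟨C, D, hCD, hC, hD, T₁, T₂, hT⟩ := exists_isTorusModel_neg_one hP
      have h2 : orderOf (-1 : ℤˣ) = 2 := orderOf_eq_prime (by simp) (by decide)
      rw [h2]
      obtain ⟨e⟩ := nonempty_gLie_matrix_equiv (hCD := hCD) (hC := hC) (hD := hD) (ρ := ρ)
        (by norm_num) hn
      exact hT.exists_quotient_equiv_directSum hn isHypSimple_matrix e V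
    · obtain ⟨C, D, hCD, hC, hD, T₁, T₂, hT⟩ := exists_isTorusModel_one
      rw [orderOf_one]
      obtain ⟨e⟩ := nonempty_gLie_matrix_equiv (hCD := hCD) (hC := hC) (hD := hD) (ρ := ρ)
        le_rfl hn
      exact hT.exists_quotient_equiv_directSum hn isHypSimple_matrix e V
  · intro h
    have hq : q = 1 ∧ θ₂ = -1 := by
      rcases h with h | h <;> simp only [Prod.mk.injEq] at h <;> exact ⟨h.1, h.2.2⟩
    obtain ⟨rfl, rfl⟩ := hq
    obtain ⟨e⟩ := nonempty_gLie_exchange_equiv_sl (k := ℂ) hn ρ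
    exact isTorusModel_exchange.exists_quotient_equiv_directSum hn (isHypSimple_exchange hn ρ) e V
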